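/- Let $n,N\ge 0$ and $m\ge 1$ be integers and let $P=(P_j(D))_{j=1}^N$ be a system of linear partial differential operators with constant complex coefficients on $\mathbb R^n$, where $D=(D_1,\dots,D_n)$, $D_j=-i\partial_{x_j}$, each $P_j$ is a polynomial of degree exactly $m$ (the system has order $m$), and $P$ is elliptic: there is $C>0$ with $$|\xi|^m\le C\Big(1+\sum_{j=1}^N|P_j(\xi)|\Big)\qquad\text{for all }\xi\in\mathbb R^n.$$ Let $\Omega\subseteq\mathbb R^n$ be open and let $\omega:[0,\infty)\to[0,\infty)$ be a non-quasianalytic weight function, that is, a continuous (weakly) increasing function such that ($\alpha$) there is $L>0$ with $\omega(2t)\le L(\omega(t)+1)$ for all $t\ge0$; ($\beta$) $\int_1^\infty \omega(t)t^{-2}\,dt<\infty$; ($\gamma$) $\log t=o(\omega(t))$ as $t\to\infty$; ($\delta$) $\varphi(t)=\omega(e^t)$ is convex on $\mathbb R$. Put $\varphi^*(s)=\sup_{t\ge0}(st-\varphi(t))$ for $s\ge0$. For $\beta\in\mathbb N_0^N$ write $P^\beta=P_1(D)^{\beta_1}\circ\cdots\circ P_N(D)^{\beta_N}$, and for compact $K\subset\Omega$,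 $\lambda>0$ and $u\in C^\infty(\Omega)$ (complex valued) put $$p_{K,\lambda}(u)=\sup_{\alpha\in\mathbb N_0^n}\sup_{x\in K}|D^\alpha u(x)|\,e^{-\lambda\varphi^*(|\alpha|/\lambda)},\qquad p^P_{K,\lambda}(u)=\sup_{\beta\in\mathbb N_0^N}\|P^\beta u\|_{L^2(K)}\,e^{-\lambda\varphi^*(|\beta|m/\lambda)}.$$ Let $\mathcal E_{(\omega)}(\Omega)$ (Beurling case) be the set of all $u\in C^\infty(\Omega)$ such that $p_{K,\lambda}(u)<\infty$ for every compact $K\subset\Omega$ and every $\lambda>0$, and let $\mathcal E_{\{\omega\}}(\Omega)$ (Roumieu case) be the set of all $u\in C^\infty(\Omega)$ such that for every compact $K\subset\Omega$ there is an integer $\ell\ge1$ with $p_{K,1/\ell}(u)<\infty$. Let $\mathcal E^P_{(\omega)}(\Omega)$ and $\mathcal E^P_{\{\omega\}}(\Omega)$ be defined in the same way with $p^P_{K,\lambda}$ in place of $p_{K,\lambda}$. Then $$\mathcal E^P_{(\omega)}(\Omega)=\mathcal E_{(\omega)}(\Omega)\qquad\text{and}\qquad \mathcal E^P_{\{\omega\}}(\Omega)=\mathcal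 E_{\{\omega\}}(\Omega).$$ -/

import Mathlib

open scoped ENNReal

namespace Ultradiff

/-- Non-quasianalytic weight functions `ω : [0,∞) → [0,∞)`; only the values of `ω` on `[0,∞)`
are constrained. -/
structure IsNonQuasianalyticWeight (ω : ℝ → ℝ) : Prop where
  continuousOn : ContinuousOn ω (Set.Ici 0)
  monotoneOn : MonotoneOn ω (Set.Ici 0)
  nonneg : ∀ t, 0 ≤ t → 0 ≤ ω t
  /-- condition (α) -/
  alpha : ∃ L : ℝ, 0 < L ∧ ∀ t, 0 ≤ t → ω (2 * t) ≤ L * (ω t + 1)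
  /-- condition (β): `∫_1^∞ ω(t) / t² dt < ∞` -/
  beta : MeasureTheory.IntegrableOn (fun t : ℝ => ω t / t ^ 2) (Set.Ioi 1)
  /-- condition (γ): `log t = o(ω(t))` as `t → ∞` -/
  gamma : Real.log =o[Filter.atTop] ω
  /-- condition (δ): `φ(t) = ω(exp t)` is convex -/
  delta : ConvexOn ℝ Set.univ (fun t : ℝ => ω (Real.exp t))

/-- The Young conjugate `φ*(s) = sup_{t ≥ 0} (s t - φ(t))` of `φ(t) = ω(exp t)`. -/
noncomputable def youngConj (ω : ℝ → ℝ) (s : ℝ) : ℝ :=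
  sSup ((fun t : ℝ => s * t - ω (Real.exp t)) '' Set.Ici 0)

/-- For a weight function the supremum that defines the Young conjugate is finite. -/
theorem IsNonQuasianalyticWeight.bddAbove {ω : ℝ → ℝ} (hω : IsNonQuasianalyticWeight ω) (s : ℝ) :
    BddAbove ((fun t : ℝ => s * t - ω (Real.exp t)) '' Set.Ici 0) := by
  have h1 : (0 : ℝ) < 1 / (|s| + 1) := by positivity
  have h2 := (hω.gamma.def h1)
  have h3 := Real.tendsto_exp_atTop.eventually h2
  obtain ⟨T, hT⟩ := Filter.eventually_atTop.1 h3
  refine ⟨|s| * |T|, ?_⟩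
  rintro _ ⟨t, ht, rfl⟩
  have ht0 : (0 : ℝ) ≤ t := ht
  have hw := hω.nonneg (Real.exp t) (Real.exp_pos t).le
  have hs := le_abs_self s
  have hs0 := abs_nonneg s
  rcases le_total T t with h | h
  · have h4 := hT t h
    rw [Real.log_exp, Real.norm_of_nonneg ht0, Real.norm_of_nonneg hw,
      div_mul_eq_mul_div, one_mul, le_div_iff₀ (by positivity)] at h4
    have h5 : 0 ≤ |s| * |T| := by positivity
    have h6 : s * t ≤ |s| * t := mul_le_mul_of_nonneg_right hs ht0
    show s * t - ω (Real.exp t) ≤ _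
    nlinarith
  · have h6 : s * t ≤ |s| * t := mul_le_mul_of_nonneg_right hs ht0
    have h7 : |s| * t ≤ |s| * |T| :=
      mul_le_mul_of_nonneg_left (h.trans (le_abs_self T)) hs0
    show s * t - ω (Real.exp t) ≤ _
    linarith

/-- The operator `D_j = -i ∂_{x_j}`. -/
noncomputable def partialD {n : ℕ} (j : Fin n) (u : EuclideanSpace ℝ (Fin n) → ℂ) :
    EuclideanSpace ℝ (Fin n) → ℂ :=
  fun x => -Complex.I * fderiv ℝ u x (EuclideanSpace.single j 1)

/-- `T_1^{β_1} ∘ T_2^{β_2} ∘ ⋯ ∘ T_N^{β_N}` applied to `u`. -/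
def iterComp {X : Type*} {N : ℕ} (T : Fin N → X → X) (β : Fin N → ℕ) (u : X) : X :=
  (List.finRange N).foldr (fun j v => (T j)^[β j] v) u

/-- `D^α = D_1^{α_1} ∘ ⋯ ∘ D_n^{α_n}`. -/
noncomputable def multiD {n : ℕ} (α : Fin n → ℕ) (u : EuclideanSpace ℝ (Fin n) → ℂ) :
    EuclideanSpace ℝ (Fin n) → ℂ :=
  iterComp partialD α u

/-- The constant coefficient operator `p(D) = ∑_α a_α D^α` with symbol `p(ξ) = ∑_α a_α ξ^α`. -/
noncomputable def diffOp {n : ℕ} (p : MvPolynomial (Fin n) ℂ)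
    (u : EuclideanSpace ℝ (Fin n) → ℂ) : EuclideanSpace ℝ (Fin n) → ℂ :=
  fun x => ∑ α ∈ p.support, p.coeff α * multiD α u x

/-- The iterates `P^β = P_1(D)^{β_1} ∘ ⋯ ∘ P_N(D)^{β_N}` of a system. -/
noncomputable def systemIter {n N : ℕ} (P : Fin N → MvPolynomial (Fin n) ℂ) (β : Fin N → ℕ)
    (u : EuclideanSpace ℝ (Fin n) → ℂ) : EuclideanSpace ℝ (Fin n) → ℂ :=
  iterComp (fun j => diffOp (P j)) β u

/-- The system has order `m`: each of its operators has order `m`. -/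
def HasOrder {n N : ℕ} (P : Fin N → MvPolynomial (Fin n) ℂ) (m : ℕ) : Prop :=
  ∀ j, (P j).totalDegree = m

/-- Ellipticity of a system of order `m`:
`|ξ|^m ≤ C (1 + ∑_j |P_j(ξ)|)` for all `ξ ∈ ℝⁿ`. -/
def IsElliptic {n N : ℕ} (P : Fin N → MvPolynomial (Fin n) ℂ) (m : ℕ) : Prop :=
  ∃ C : ℝ, 0 < C ∧ ∀ ξ : EuclideanSpace ℝ (Fin n),
    ‖ξ‖ ^ m ≤ C * (1 + ∑ j, ‖MvPolynomial.eval (fun i => (ξ i : ℂ)) (P j)‖)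

/-- The factor `exp(-λ φ*(k / λ))`. -/
noncomputable def weightFactor (ω : ℝ → ℝ) (lam : ℝ) (k : ℕ) : ℝ≥0∞ :=
  ENNReal.ofReal (Real.exp (-(lam * youngConj ω (k / lam))))

/-- `p_{K,λ}(u) = sup_α sup_{x ∈ K} |D^α u(x)| exp(-λ φ*(|α| / λ))`. -/
noncomputable def seminormD {n : ℕ} (ω : ℝ → ℝ) (K : Set (EuclideanSpace ℝ (Fin n))) (lam : ℝ)
    (u : EuclideanSpace ℝ (Fin n) → ℂ) : ℝ≥0∞ :=
  ⨆ α : Fin n → ℕ, ⨆ x ∈ K, ‖multiD α u x‖ₑ * weightFactor ω lam (∑ i, α i)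

/-- `p^P_{K,λ}(u) = sup_β ‖P^β u‖_{L²(K)} exp(-λ φ*(|β| m / λ))`, for a system of order `m`. -/
noncomputable def seminormP {n N : ℕ} (P : Fin N → MvPolynomial (Fin n) ℂ) (m : ℕ) (ω : ℝ → ℝ)
    (K : Set (EuclideanSpace ℝ (Fin n))) (lam : ℝ)
    (u : EuclideanSpace ℝ (Fin n) → ℂ) : ℝ≥0∞ :=
  ⨆ β : Fin N → ℕ,
    MeasureTheory.eLpNorm (systemIter P β u) 2 (MeasureTheory.volume.restrict K) *
      weightFactor ω lam ((∑ j, β j) * m)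

/-!
Functions on an open set `Ω` are represented by functions on the whole space; membership in the
four spaces below depends only on the restriction of the function to `Ω`.
-/

/-- `E_(ω)(Ω)`: the Beurling type ultradifferentiable functions. -/
def beurling {n : ℕ} (ω : ℝ → ℝ) (Ω : Set (EuclideanSpace ℝ (Fin n))) :
    Set (EuclideanSpace ℝ (Fin n) → ℂ) :=
  {u | ContDiffOn ℝ ((⊤ : ℕ∞) : WithTop ℕ∞) u Ω ∧ ∀ K ⊆ Ω, IsCompact K →
    ∀ lam : ℝ, 0 < lam → seminormD ω K lam u < ⊤}

/-- `E_{ω}(Ω)`: the Roumieu type ultradifferentiable functions. -/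
def roumieu {n : ℕ} (ω : ℝ → ℝ) (Ω : Set (EuclideanSpace ℝ (Fin n))) :
    Set (EuclideanSpace ℝ (Fin n) → ℂ) :=
  {u | ContDiffOn ℝ ((⊤ : ℕ∞) : WithTop ℕ∞) u Ω ∧ ∀ K ⊆ Ω, IsCompact K →
    ∃ l : ℕ, 0 < l ∧ seminormD ω K (1 / (l : ℝ)) u < ⊤}

/-- `E^P_(ω)(Ω)`: the Beurling type space with respect to the iterates of a system `P` of
order `m`. -/
def beurlingIter {n N : ℕ} (P : Fin N → MvPolynomial (Fin n) ℂ) (m : ℕ) (ω : ℝ → ℝ)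
    (Ω : Set (EuclideanSpace ℝ (Fin n))) : Set (EuclideanSpace ℝ (Fin n) → ℂ) :=
  {u | ContDiffOn ℝ ((⊤ : ℕ∞) : WithTop ℕ∞) u Ω ∧ ∀ K ⊆ Ω, IsCompact K →
    ∀ lam : ℝ, 0 < lam → seminormP P m ω K lam u < ⊤}

/-- `E^P_{ω}(Ω)`: the Roumieu type space with respect to the iterates of a system `P` of
order `m`. -/
def roumieuIter {n N : ℕ} (P : Fin N → MvPolynomial (Fin n) ℂ) (m : ℕ) (ω : ℝ → ℝ)
    (Ω : Set (EuclideanSpace ℝ (Fin n))) : Set (EuclideanSpace ℝ (Fin n) → ℂ) :=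
  {u | ContDiffOn ℝ ((⊤ : ℕ∞) : WithTop ℕ∞) u Ω ∧ ∀ K ⊆ Ω, IsCompact K →
    ∃ l : ℕ, 0 < l ∧ seminormP P m ω K (1 / (l : ℝ)) u < ⊤}

end Ultradiff

/-!
# The theorem of iterates for elliptic systems with constant coefficients

Near a compact subset of `Ω` a smooth function agrees with a Schwartz function, so that all
estimates are made for Schwartz functions, on which `p(D)` is a Fourier multiplier (`polyOp`) and
operators compose by multiplication of polynomials.

That ultradifferentiable functions satisfy the bounds for the iterates is elementary: `P^β` is a
combination of derivatives of order at most `m|β|` with coefficients of geometric growth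
(`exists_enorm_iterate_le`), and geometric factors are absorbed by a change of `λ` thanks to
condition (α) (`IsNonQuasianalyticWeight.exists_scaledConj_absorb`).

The converse rests on the interior elliptic estimate
`δ^|α| ‖D^α v‖_{L²(A)} ≤ C (‖v‖_{L²(B)} + δ^m ∑_j ‖P_j(D) v‖_{L²(B)})` for `|α| ≤ m`, where `B`
contains a `δ`-neighbourhood of `A` and `C` does not depend on `δ ≤ 1` (`localL2_listD_le`). It is
obtained by showing that, for cutoff functions `χ` with `|∂^γ χ| ≤ c_γ δ^{-|γ|}`, the Sobolev norm
of `χ v` of order `s ≤ m` with weight `(1 + δ|ξ|)^s` is controlled (`cutoffEstimate`), by induction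
on `s`: the step from `s` to `s + 1` uses ellipticity on the Fourier side, and the commutators
`[P_j(D), χ]` only involve the estimate of order `s` for derivatives of `χ`. As the Sobolev norms
have negative order where necessary, no interpolation inequality is needed.

Iterating the interior estimate `k` times with `δ = ε / k` bounds the derivatives of order `mk` by
`C^k ∑_{b ≤ k} (k/ε)^{m(k-b)} max_{|β| = b} ‖P^β v‖`, and a Sobolev inequality turns this into
pointwise bounds (`exists_enorm_listD_le`). The factor `k^{m(k-b)}` is harmless because condition
(β) implies `ω(t) = o(t)`, so that the weight sequences `exp(λ φ*(i/λ))` dominate `e^{-i} i^i` for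
every `λ`, and because they are supermultiplicative
(`IsNonQuasianalyticWeight.exists_pow_mul_exp_le`). All losses amount to replacing `λ` by `λ / L`
with `L` independent of `λ`, which covers the Beurling and the Roumieu case at once.
-/

namespace Ultradiff

open MeasureTheory SchwartzMap FourierTransform
open scoped NNReal

variable {n N : ℕ}

/-! ### Constant coefficient operators on Schwartz functions -/

/-- The symbol of `p(D)` with respect to Mathlib's normalisation of the Fourier transform, in which
`D_j = -i ∂_j` corresponds to multiplication by `2π ξ_j`. -/
noncomputable def fourierSymbol (p : MvPolynomial (Fin n) ℂ) (ξ : EuclideanSpace ℝ (Fin n)) : ℂ :=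
  MvPolynomial.eval (fun i => ((2 * Real.pi * ξ i : ℝ) : ℂ)) p

theorem hasTemperateGrowth_fourierSymbol (p : MvPolynomial (Fin n) ℂ) :
    (fourierSymbol p).HasTemperateGrowth := by
  induction p using MvPolynomial.induction_on with
  | C a =>
    have : fourierSymbol (n := n) (MvPolynomial.C a) = fun _ => a := by
      ext ξ; simp [fourierSymbol]
    rw [this]; exact .const a
  | add p q hp hq =>
    have : fourierSymbol (p + q) = fourierSymbol p + fourierSymbol q := by
      ext ξ; simp [fourierSymbol]
    rw [this]; exact hp.add hq
  | mul_X p i hp =>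
    have : fourierSymbol (p * MvPolynomial.X i) = fourierSymbol p *
        fun ξ => ((2 * Real.pi : ℝ) : ℂ) * ((EuclideanSpace.proj (𝕜 := ℝ) i ξ : ℝ) : ℂ) := by
      ext ξ; simp [fourierSymbol]
    rw [this]
    refine hp.mul (Function.HasTemperateGrowth.mul (.const _) ?_)
    exact Function.HasTemperateGrowth.comp Complex.ofRealCLM.hasTemperateGrowth
      (EuclideanSpace.proj (𝕜 := ℝ) i).hasTemperateGrowth

/-- The operator `p(D)` on Schwartz functions, encoded as a Fourier multiplier. -/
noncomputable def polyOp (p : MvPolynomial (Fin n) ℂ) :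
    𝓢(EuclideanSpace ℝ (Fin n), ℂ) →L[ℂ] 𝓢(EuclideanSpace ℝ (Fin n), ℂ) :=
  fourierMultiplierCLM ℂ (fourierSymbol p)

theorem fourier_polyOp (p : MvPolynomial (Fin n) ℂ) (u : 𝓢(EuclideanSpace ℝ (Fin n), ℂ))
    (ξ : EuclideanSpace ℝ (Fin n)) : 𝓕 (polyOp p u) ξ = fourierSymbol p ξ * 𝓕 u ξ := by
  rw [polyOp, fourierMultiplierCLM_apply, FourierTransform.fourier_fourierInv_eq,
    smulLeftCLM_apply_apply (hasTemperateGrowth_fourierSymbol p), smul_eq_mul]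

theorem eq_of_fourier_eq {u v : 𝓢(EuclideanSpace ℝ (Fin n), ℂ)} (h : ∀ ξ, 𝓕 u ξ = 𝓕 v ξ) :
    u = v := by
  have h' : 𝓕 u = 𝓕 v := by ext ξ; exact h ξ
  rw [← FourierTransform.fourierInv_fourier_eq (F := 𝓢(EuclideanSpace ℝ (Fin n), ℂ)) u, h',
    FourierTransform.fourierInv_fourier_eq]

theorem fourier_add_apply (u v : 𝓢(EuclideanSpace ℝ (Fin n), ℂ)) (ξ : EuclideanSpace ℝ (Fin n)) :
    𝓕 (u + v) ξ = 𝓕 u ξ + 𝓕 v ξ := by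
  rw [FourierTransform.fourier_add]; rfl

theorem fourier_smul_apply (a : ℂ) (u : 𝓢(EuclideanSpace ℝ (Fin n), ℂ))
    (ξ : EuclideanSpace ℝ (Fin n)) : 𝓕 (a • u) ξ = a * 𝓕 u ξ := by
  rw [FourierTransform.fourier_smul]; rfl

theorem polyOp_mul (p q : MvPolynomial (Fin n) ℂ) (u : 𝓢(EuclideanSpace ℝ (Fin n), ℂ)) :
    polyOp (p * q) u = polyOp p (polyOp q u) := by
  refine eq_of_fourier_eq fun ξ => ?_
  simp only [fourier_polyOp, fourierSymbol, map_mul, mul_assoc]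

theorem polyOp_one (u : 𝓢(EuclideanSpace ℝ (Fin n), ℂ)) : polyOp 1 u = u := by
  refine eq_of_fourier_eq fun ξ => ?_
  simp only [fourier_polyOp, fourierSymbol, map_one, one_mul]

theorem polyOp_add (p q : MvPolynomial (Fin n) ℂ) (u : 𝓢(EuclideanSpace ℝ (Fin n), ℂ)) :
    polyOp (p + q) u = polyOp p u + polyOp q u := by
  refine eq_of_fourier_eq fun ξ => ?_
  simp only [fourier_polyOp, fourierSymbol, map_add, fourier_add_apply, add_mul]

theorem polyOp_zero (u : 𝓢(EuclideanSpace ℝ (Fin n), ℂ)) : polyOp 0 u = 0 := by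
  simpa using polyOp_add 0 0 u

theorem polyOp_comm (p q : MvPolynomial (Fin n) ℂ) (u : 𝓢(EuclideanSpace ℝ (Fin n), ℂ)) :
    polyOp p (polyOp q u) = polyOp q (polyOp p u) := by
  rw [← polyOp_mul, mul_comm, polyOp_mul]

theorem polyOp_sum {ι : Type*} (s : Finset ι) (p : ι → MvPolynomial (Fin n) ℂ)
    (u : 𝓢(EuclideanSpace ℝ (Fin n), ℂ)) : polyOp (∑ i ∈ s, p i) u = ∑ i ∈ s, polyOp (p i) u := by
  classical
  induction s using Finset.induction_on with
  | empty => simp [polyOp_zero]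
  | insert a s ha ih => rw [Finset.sum_insert ha, Finset.sum_insert ha, polyOp_add, ih]

theorem polyOp_smul (a : ℂ) (p : MvPolynomial (Fin n) ℂ) (u : 𝓢(EuclideanSpace ℝ (Fin n), ℂ)) :
    polyOp (a • p) u = a • polyOp p u := by
  refine eq_of_fourier_eq fun ξ => ?_
  simp only [fourier_polyOp, fourierSymbol, MvPolynomial.smul_eval, fourier_smul_apply, mul_assoc]

theorem polyOp_eq_sum (p : MvPolynomial (Fin n) ℂ) (u : 𝓢(EuclideanSpace ℝ (Fin n), ℂ)) :
    polyOp p u = ∑ α ∈ p.support, p.coeff α • polyOp (MvPolynomial.monomial α 1) u := by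
  conv_lhs => rw [p.as_sum, polyOp_sum]
  refine Finset.sum_congr rfl fun α _ => ?_
  rw [← polyOp_smul, MvPolynomial.smul_monomial, smul_eq_mul, mul_one]

/-- The normalisation of `fourierSymbol` is the one for which `X j` is the symbol of `D_j`. -/
theorem coe_polyOp_X (j : Fin n) (u : 𝓢(EuclideanSpace ℝ (Fin n), ℂ)) :
    ⇑(polyOp (MvPolynomial.X j) u) = partialD j ⇑u := by
  have h : polyOp (MvPolynomial.X j) u =
      (-Complex.I) • LineDeriv.lineDerivOp (EuclideanSpace.single j (1 : ℝ)) u := by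
    refine eq_of_fourier_eq fun ξ => ?_
    rw [fourier_polyOp, fourier_smul_apply, fourier_lineDerivOp_eq, _root_.smul_apply,
      smulLeftCLM_apply_apply (by fun_prop), EuclideanSpace.inner_single_right]
    simp only [fourierSymbol, MvPolynomial.eval_X, smul_eq_mul, Complex.real_smul]
    push_cast
    simp
    linear_combination (2 * Real.pi * ξ j * 𝓕 u ξ) * Complex.I_sq
  ext x
  rw [h, _root_.smul_apply, SchwartzMap.lineDerivOp_apply_eq_fderiv]
  rfl

/-- On Schwartz functions, iterated compositions of constant coefficient operators are given by
products of polynomials. -/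
theorem iterComp_coe {M : ℕ}
    (T : Fin M → (EuclideanSpace ℝ (Fin n) → ℂ) → (EuclideanSpace ℝ (Fin n) → ℂ))
    (p : Fin M → MvPolynomial (Fin n) ℂ)
    (h : ∀ (j) (v : 𝓢(EuclideanSpace ℝ (Fin n), ℂ)), T j ⇑v = ⇑(polyOp (p j) v))
    (β : Fin M → ℕ) (u : 𝓢(EuclideanSpace ℝ (Fin n), ℂ)) :
    iterComp T β ⇑u = ⇑(polyOp (∏ j, p j ^ β j) u) := by
  have h1 : ∀ (j) (k : ℕ) (v : 𝓢(EuclideanSpace ℝ (Fin n), ℂ)),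
      (T j)^[k] ⇑v = ⇑(polyOp (p j ^ k) v) := by
    intro j k
    induction k with
    | zero => intro v; simp [polyOp_one]
    | succ k ih => intro v; rw [Function.iterate_succ_apply, h, ih, ← polyOp_mul, pow_succ]
  rw [iterComp, Fin.prod_univ_def]
  induction List.finRange M with
  | nil => simp [polyOp_one]
  | cons j l ih => rw [List.foldr_cons, ih, h1, ← polyOp_mul, List.map_cons, List.prod_cons]

theorem multiD_coe (α : Fin n → ℕ) (u : 𝓢(EuclideanSpace ℝ (Fin n), ℂ)) :
    multiD α ⇑u = ⇑(polyOp (∏ j, MvPolynomial.X j ^ α j) u) :=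
  iterComp_coe _ _ (fun j v => (coe_polyOp_X j v).symm) α u

theorem monomial_one_eq_prod_X (α : Fin n →₀ ℕ) :
    (MvPolynomial.monomial α 1 : MvPolynomial (Fin n) ℂ) = ∏ j, MvPolynomial.X j ^ α j := by
  rw [MvPolynomial.monomial_eq, Finsupp.prod_fintype _ _ (by simp)]; simp

theorem diffOp_coe (p : MvPolynomial (Fin n) ℂ) (u : 𝓢(EuclideanSpace ℝ (Fin n), ℂ)) :
    diffOp p ⇑u = ⇑(polyOp p u) := by
  ext x
  rw [polyOp_eq_sum, _root_.sum_apply, diffOp]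
  refine Finset.sum_congr rfl fun α _ => ?_
  rw [multiD_coe, _root_.smul_apply, smul_eq_mul, monomial_one_eq_prod_X]

theorem systemIter_coe (P : Fin N → MvPolynomial (Fin n) ℂ) (β : Fin N → ℕ)
    (u : 𝓢(EuclideanSpace ℝ (Fin n), ℂ)) :
    systemIter P β ⇑u = ⇑(polyOp (∏ j, P j ^ β j) u) :=
  iterComp_coe _ _ (fun j v => diffOp_coe (P j) v) β u

section EllipticRegularity

open scoped ContDiff

/-! ### Cutoff functions -/

/-- `χ` is a smooth function supported in `B` whose derivatives of order `k` are bounded by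
`c k / δ ^ k`. The sequence `c` is what estimates have to be uniform in: it controls a whole family
of cutoff functions with transition regions of width `δ`. -/
structure IsScaledCutoff (c : ℕ → ℝ) (δ : ℝ) (B : Set (EuclideanSpace ℝ (Fin n)))
    (χ : EuclideanSpace ℝ (Fin n) → ℂ) : Prop where
  contDiff : ContDiff ℝ ∞ χ
  bound : ∀ k x, δ ^ k * ‖iteratedFDeriv ℝ k χ x‖ ≤ c k
  tsupport_subset : tsupport χ ⊆ B

namespace IsScaledCutoff

variable {c : ℕ → ℝ} {δ : ℝ} {B : Set (EuclideanSpace ℝ (Fin n))}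
  {χ : EuclideanSpace ℝ (Fin n) → ℂ}

theorem hasTemperateGrowth (h : IsScaledCutoff c δ B χ) (hδ : 0 < δ) : χ.HasTemperateGrowth := by
  refine ⟨h.contDiff, fun k => ⟨0, c k / δ ^ k, fun x => ?_⟩⟩
  rw [pow_zero, mul_one, le_div_iff₀ (by positivity), mul_comm]
  exact h.bound k x

theorem norm_le (h : IsScaledCutoff c δ B χ) (x : EuclideanSpace ℝ (Fin n)) : ‖χ x‖ ≤ c 0 := by
  simpa using h.bound 0 x

theorem eq_zero (h : IsScaledCutoff c δ B χ) {x : EuclideanSpace ℝ (Fin n)} (hx : x ∉ B) :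
    χ x = 0 :=
  image_eq_zero_of_notMem_tsupport fun h' => hx (h.tsupport_subset h')

/-- The class of scaled cutoff functions is stable under the scaled derivatives `δ D_i`. -/
theorem smul_partialD (h : IsScaledCutoff c δ B χ) (hδ : 0 < δ) (i : Fin n) :
    IsScaledCutoff (fun k => c (k + 1)) δ B ((δ : ℂ) • partialD i χ) := by
  have e : (δ : ℂ) • partialD i χ = fun x => ((δ : ℂ) * (-Complex.I)) •
      fderiv ℝ χ x (EuclideanSpace.single i 1) := by
    ext x; simp [partialD, mul_assoc]
  have hf : ContDiff ℝ ∞ (fderiv ℝ χ) := h.contDiff.fderiv_right (by simp)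
  have hf' : ContDiff ℝ ∞ (fun x => fderiv ℝ χ x (EuclideanSpace.single i 1)) :=
    hf.clm_apply contDiff_const
  rw [e]
  refine ⟨hf'.const_smul _, fun k x => ?_, ?_⟩
  · rw [show (fun x => ((δ : ℂ) * (-Complex.I)) • fderiv ℝ χ x (EuclideanSpace.single i 1)) =
        ((δ : ℂ) * (-Complex.I)) • fun x => fderiv ℝ χ x (EuclideanSpace.single i 1) from rfl,
      iteratedFDeriv_const_smul_apply (hf'.contDiffAt.of_le (by exact_mod_cast le_top)), norm_smul]
    have h1 := norm_iteratedFDeriv_clm_apply_const (c := EuclideanSpace.single i (1 : ℝ)) (n := k)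
      (N := k) (hf.contDiffAt (x := x) |>.of_le (by exact_mod_cast le_top)) le_rfl
    rw [norm_iteratedFDeriv_fderiv] at h1
    have h2 : ‖(δ : ℂ) * (-Complex.I)‖ = δ := by simp [abs_of_pos hδ]
    have h3 : ‖EuclideanSpace.single i (1 : ℝ)‖ = 1 := by simp
    rw [h3, one_mul] at h1
    rw [h2]
    calc _ ≤ δ ^ k * (δ * ‖iteratedFDeriv ℝ (k + 1) χ x‖) := by gcongr
      _ = δ ^ (k + 1) * ‖iteratedFDeriv ℝ (k + 1) χ x‖ := by ring
      _ ≤ _ := h.bound _ _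
  · refine (closure_minimal ?_ (isClosed_tsupport χ)).trans h.tsupport_subset
    intro x hx
    by_contra hx'
    have := image_eq_zero_of_notMem_tsupport
      (fun h => hx' (tsupport_fderiv_subset ℝ (f := χ) h) : x ∉ tsupport (fderiv ℝ χ))
    simp [this] at hx

end IsScaledCutoff

theorem polyOp_X_smulLeftCLM {χ : EuclideanSpace ℝ (Fin n) → ℂ} (i : Fin n)
    (hχ : χ.HasTemperateGrowth) (hχ' : (partialD i χ).HasTemperateGrowth)
    (v : 𝓢(EuclideanSpace ℝ (Fin n), ℂ)) :
    polyOp (MvPolynomial.X i) (smulLeftCLM ℂ χ v) =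
      smulLeftCLM ℂ χ (polyOp (MvPolynomial.X i) v) + smulLeftCLM ℂ (partialD i χ) v := by
  ext x
  rw [_root_.add_apply, smulLeftCLM_apply_apply hχ, smulLeftCLM_apply_apply hχ', coe_polyOp_X,
    coe_polyOp_X, smulLeftCLM_apply hχ, partialD, partialD, partialD]
  have h1 := hχ.1.differentiable (by simp) x
  have h2 := v.differentiable x
  simp only [smul_eq_mul]
  rw [fderiv_fun_mul h1 h2]
  simp
  ring

/-! ### Weighted norms -/

/-- The scaled Sobolev norm `‖(1 + δ|ξ|)^s v̂‖_{L²}`, of arbitrary integer order `s`. -/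
noncomputable def sobNorm (δ : ℝ) (s : ℤ) (v : 𝓢(EuclideanSpace ℝ (Fin n), ℂ)) : ℝ≥0∞ :=
  eLpNorm (fun ξ => (1 + δ * ‖ξ‖) ^ s * ‖𝓕 v ξ‖) 2 volume

theorem measurable_sobNorm_integrand (δ : ℝ) (s : ℤ) (v : 𝓢(EuclideanSpace ℝ (Fin n), ℂ)) :
    AEStronglyMeasurable (fun ξ => (1 + δ * ‖ξ‖) ^ s * ‖𝓕 v ξ‖) volume := by
  refine Measurable.aestronglyMeasurable ?_
  have : Measurable fun ξ => 𝓕 v ξ := (𝓕 v).continuous.measurable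
  have h2 : Measurable fun ξ : EuclideanSpace ℝ (Fin n) => (1 + δ * ‖ξ‖) ^ s := by
    have h3 : Measurable fun ξ : EuclideanSpace ℝ (Fin n) => 1 + δ * ‖ξ‖ := by fun_prop
    cases s with
    | ofNat k => simpa using h3.pow_const k
    | negSucc k => simpa [zpow_negSucc] using h3.pow_const (k + 1)
  exact h2.mul this.norm

theorem sobNorm_le_of_le {δ : ℝ} (hδ : 0 ≤ δ) {s t : ℤ} (C : ℝ≥0)
    {u v : 𝓢(EuclideanSpace ℝ (Fin n), ℂ)}
    (h : ∀ ξ, (1 + δ * ‖ξ‖) ^ s * ‖𝓕 u ξ‖ ≤ C * ((1 + δ * ‖ξ‖) ^ t * ‖𝓕 v ξ‖)) :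
    sobNorm δ s u ≤ C * sobNorm δ t v := by
  refine (eLpNorm_le_nnreal_smul_eLpNorm_of_ae_le_mul
    (Filter.Eventually.of_forall fun ξ => ?_) 2)
  rw [← NNReal.coe_le_coe, NNReal.coe_mul]
  rw [coe_nnnorm, coe_nnnorm, Real.norm_of_nonneg (by positivity),
    Real.norm_of_nonneg (by positivity)]
  exact h ξ

theorem sobNorm_add_le (δ : ℝ) (hδ : 0 ≤ δ) (s : ℤ) (u v : 𝓢(EuclideanSpace ℝ (Fin n), ℂ)) :
    sobNorm δ s (u + v) ≤ sobNorm δ s u + sobNorm δ s v := by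
  refine le_trans ?_ (eLpNorm_add_le (measurable_sobNorm_integrand δ s u)
    (measurable_sobNorm_integrand δ s v) (by norm_num))
  refine eLpNorm_mono_real fun ξ => ?_
  rw [Real.norm_of_nonneg (by positivity), Pi.add_apply, ← mul_add, fourier_add_apply]
  gcongr
  exact norm_add_le _ _

theorem sobNorm_smul {δ : ℝ} (s : ℤ) (a : ℂ) (v : 𝓢(EuclideanSpace ℝ (Fin n), ℂ)) :
    sobNorm δ s (a • v) = ‖a‖ₑ * sobNorm δ s v := by
  have : (fun ξ => (1 + δ * ‖ξ‖) ^ s * ‖𝓕 (a • v) ξ‖) =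
      ‖a‖ • fun ξ => (1 + δ * ‖ξ‖) ^ s * ‖𝓕 v ξ‖ := by
    ext ξ
    rw [fourier_smul_apply, norm_mul, Pi.smul_apply, smul_eq_mul]; ring
  rw [sobNorm, this, eLpNorm_const_smul, enorm_norm, sobNorm]

theorem sobNorm_zero_right (δ : ℝ) (s : ℤ) :
    sobNorm δ s (0 : 𝓢(EuclideanSpace ℝ (Fin n), ℂ)) = 0 := by
  simpa using sobNorm_smul (δ := δ) s 0 (0 : 𝓢(EuclideanSpace ℝ (Fin n), ℂ))

theorem sobNorm_sub_le (δ : ℝ) (hδ : 0 ≤ δ) (s : ℤ) (u v : 𝓢(EuclideanSpace ℝ (Fin n), ℂ)) :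
    sobNorm δ s (u - v) ≤ sobNorm δ s u + sobNorm δ s v := by
  rw [sub_eq_add_neg, ← neg_one_smul ℂ v]
  refine (sobNorm_add_le δ hδ s _ _).trans ?_
  rw [sobNorm_smul]; simp

theorem sobNorm_sum_le {ι : Type*} (δ : ℝ) (hδ : 0 ≤ δ) (s : ℤ) (t : Finset ι)
    (u : ι → 𝓢(EuclideanSpace ℝ (Fin n), ℂ)) :
    sobNorm δ s (∑ i ∈ t, u i) ≤ ∑ i ∈ t, sobNorm δ s (u i) := by
  classical
  induction t using Finset.induction_on with
  | empty => simp [sobNorm_zero_right]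
  | insert a t ha ih =>
    rw [Finset.sum_insert ha, Finset.sum_insert ha]
    exact (sobNorm_add_le δ hδ s _ _).trans (by gcongr)

theorem sobNorm_mono {δ : ℝ} (hδ : 0 ≤ δ) {s t : ℤ} (hst : s ≤ t)
    (v : 𝓢(EuclideanSpace ℝ (Fin n), ℂ)) : sobNorm δ s v ≤ sobNorm δ t v := by
  have := sobNorm_le_of_le hδ (s := s) (t := t) 1 (u := v) (v := v) fun ξ => by
    rw [NNReal.coe_one, one_mul]
    gcongr
    exact le_add_of_nonneg_right (by positivity)
  simpa using this

theorem eLpNorm_eq_of_norm_toLp_eq {v w : 𝓢(EuclideanSpace ℝ (Fin n), ℂ)}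
    (h : ‖w.toLp 2 volume‖ = ‖v.toLp 2 volume‖) : eLpNorm w 2 volume = eLpNorm v 2 volume := by
  rw [norm_toLp, norm_toLp] at h
  have hw := w.memLp 2 volume
  have hv := v.memLp 2 volume
  exact (ENNReal.toReal_eq_toReal_iff' hw.2.ne hv.2.ne).1 h

/-- Plancherel's theorem. -/
theorem sobNorm_order_zero (δ : ℝ) (v : 𝓢(EuclideanSpace ℝ (Fin n), ℂ)) :
    sobNorm δ 0 v = eLpNorm v 2 volume := by
  have h1 : sobNorm δ 0 v = eLpNorm (fun ξ => 𝓕 v ξ) 2 volume := by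
    simp only [sobNorm, zpow_zero, one_mul]
    exact eLpNorm_norm _
  rw [h1]
  exact eLpNorm_eq_of_norm_toLp_eq (norm_fourier_toL2_eq v)

theorem norm_two_pi_mul_le (ξ : EuclideanSpace ℝ (Fin n)) (i : Fin n) :
    ‖fourierSymbol (MvPolynomial.X i) ξ‖ ≤ 2 * Real.pi * ‖ξ‖ := by
  rw [fourierSymbol, MvPolynomial.eval_X, Complex.norm_real, norm_mul,
    Real.norm_of_nonneg (by positivity)]
  gcongr
  exact PiLp.norm_apply_le ξ i

/-- A scaled derivative `δ D_i` costs one order in the scaled Sobolev norms. -/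
theorem sobNorm_polyOp_X_le {δ : ℝ} (hδ : 0 ≤ δ) (s : ℤ) (i : Fin n)
    (v : 𝓢(EuclideanSpace ℝ (Fin n), ℂ)) :
    ENNReal.ofReal δ * sobNorm δ s (polyOp (MvPolynomial.X i) v) ≤
      ENNReal.ofReal (2 * Real.pi) * sobNorm δ (s + 1) v := by
  have h0 : ENNReal.ofReal δ = ‖(δ : ℂ)‖ₑ := by
    rw [← ofReal_norm, Complex.norm_real, Real.norm_of_nonneg hδ]
  rw [h0, ← sobNorm_smul]
  refine sobNorm_le_of_le hδ _ fun ξ => ?_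
  rw [fourier_smul_apply, fourier_polyOp, norm_mul, norm_mul, Complex.norm_real,
    Real.norm_of_nonneg hδ, Real.coe_toNNReal _ (by positivity)]
  have h1 : 0 < 1 + δ * ‖ξ‖ := by positivity
  rw [zpow_add_one₀ h1.ne']
  have h2 : δ * ‖fourierSymbol (MvPolynomial.X i) ξ‖ ≤ 2 * Real.pi * (1 + δ * ‖ξ‖) := by
    calc _ ≤ δ * (2 * Real.pi * ‖ξ‖) := by gcongr; exact norm_two_pi_mul_le ξ i
      _ = 2 * Real.pi * (0 + δ * ‖ξ‖) := by ring
      _ ≤ _ := by gcongr; exact zero_le_one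
  calc (1 + δ * ‖ξ‖) ^ s * (δ * (‖fourierSymbol (MvPolynomial.X i) ξ‖ * ‖𝓕 v ξ‖))
      = (1 + δ * ‖ξ‖) ^ s * (δ * ‖fourierSymbol (MvPolynomial.X i) ξ‖) * ‖𝓕 v ξ‖ := by ring
    _ ≤ (1 + δ * ‖ξ‖) ^ s * (2 * Real.pi * (1 + δ * ‖ξ‖)) * ‖𝓕 v ξ‖ := by gcongr
    _ = _ := by ring

/-! ### Derivatives along lists of coordinates -/

/-- The derivative `D_{i_1} ⋯ D_{i_k}` along a list `[i_1, …, i_k]` of coordinates. -/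
noncomputable def listD (l : List (Fin n)) :
    𝓢(EuclideanSpace ℝ (Fin n), ℂ) →L[ℂ] 𝓢(EuclideanSpace ℝ (Fin n), ℂ) :=
  polyOp (l.map MvPolynomial.X).prod

theorem listD_nil (v : 𝓢(EuclideanSpace ℝ (Fin n), ℂ)) : listD [] v = v := by
  simp [listD, polyOp_one]

theorem listD_cons (i : Fin n) (l : List (Fin n)) (v : 𝓢(EuclideanSpace ℝ (Fin n), ℂ)) :
    listD (i :: l) v = polyOp (MvPolynomial.X i) (listD l v) := by
  rw [listD, List.map_cons, List.prod_cons, polyOp_mul]; rfl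

theorem listD_append (l l' : List (Fin n)) (v : 𝓢(EuclideanSpace ℝ (Fin n), ℂ)) :
    listD (l ++ l') v = listD l (listD l' v) := by
  rw [listD, List.map_append, List.prod_append, polyOp_mul]; rfl

/-- Lists stand for multi-indices; they make inductions on the order of a derivative structural. -/
theorem exists_list_monomial (α : Fin n →₀ ℕ) : ∃ l : List (Fin n), l.length = α.degree ∧
    (MvPolynomial.monomial α 1 : MvPolynomial (Fin n) ℂ) = (l.map MvPolynomial.X).prod := by
  induction α using Finsupp.induction_linear with
  | zero => exact ⟨[], by simp, by simp⟩
  | add f g hf hg =>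
    obtain ⟨l, h1, h2⟩ := hf
    obtain ⟨l', h1', h2'⟩ := hg
    refine ⟨l ++ l', by simp [h1, h1'], ?_⟩
    rw [List.map_append, List.prod_append, ← h2, ← h2', MvPolynomial.monomial_mul, one_mul]
  | single i k =>
    refine ⟨List.replicate k i, by simp, ?_⟩
    rw [List.map_replicate, List.prod_replicate, MvPolynomial.X_pow_eq_monomial]

theorem sobNorm_listD_le {δ : ℝ} (hδ : 0 ≤ δ) (l : List (Fin n)) :
    ∀ (s : ℤ) (v : 𝓢(EuclideanSpace ℝ (Fin n), ℂ)),
    ENNReal.ofReal (δ ^ l.length) * sobNorm δ s (listD l v) ≤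
      ENNReal.ofReal ((2 * Real.pi) ^ l.length) * sobNorm δ (s + l.length) v := by
  induction l with
  | nil => intro s v; simp [listD_nil]
  | cons i l ih =>
    intro s v
    rw [listD_cons, List.length_cons, pow_succ, pow_succ, ENNReal.ofReal_mul (by positivity),
      ENNReal.ofReal_mul (by positivity)]
    calc _ = ENNReal.ofReal (δ ^ l.length) *
          (ENNReal.ofReal δ * sobNorm δ s (polyOp (MvPolynomial.X i) (listD l v))) := by ring
      _ ≤ ENNReal.ofReal (δ ^ l.length) *
          (ENNReal.ofReal (2 * Real.pi) * sobNorm δ (s + 1) (listD l v)) := by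
        exact mul_le_mul_right (sobNorm_polyOp_X_le hδ s i _) _
      _ = ENNReal.ofReal (2 * Real.pi) *
          (ENNReal.ofReal (δ ^ l.length) * sobNorm δ (s + 1) (listD l v)) := by ring
      _ ≤ ENNReal.ofReal (2 * Real.pi) * (ENNReal.ofReal ((2 * Real.pi) ^ l.length) *
          sobNorm δ (s + 1 + l.length) v) := by exact mul_le_mul_right (ih _ _) _
      _ = _ := by
        rw [show s + 1 + (l.length : ℤ) = s + ((l.length + 1 : ℕ) : ℤ) by push_cast; ring]
        ring

/-! ### The interior elliptic estimate -/

/-- The `L²` norm over `B`. -/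
noncomputable def localL2 (B : Set (EuclideanSpace ℝ (Fin n)))
    (v : 𝓢(EuclideanSpace ℝ (Fin n), ℂ)) : ℝ≥0∞ :=
  eLpNorm v 2 (volume.restrict B)

/-- The scaled graph norm `‖v‖_{L²(B)} + δ^m ∑_j ‖P_j(D) v‖_{L²(B)}` of a system of order `m`. -/
noncomputable def graphNorm (P : Fin N → MvPolynomial (Fin n) ℂ) (m : ℕ) (δ : ℝ)
    (B : Set (EuclideanSpace ℝ (Fin n))) (v : 𝓢(EuclideanSpace ℝ (Fin n), ℂ)) : ℝ≥0∞ :=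
  localL2 B v + ENNReal.ofReal (δ ^ m) * ∑ j, localL2 B (polyOp (P j) v)

theorem sobNorm_zero_smulLeftCLM_le {c : ℕ → ℝ} {δ : ℝ} {B : Set (EuclideanSpace ℝ (Fin n))}
    {χ : EuclideanSpace ℝ (Fin n) → ℂ} (h : IsScaledCutoff c δ B χ) (hδ : 0 < δ)
    (v : 𝓢(EuclideanSpace ℝ (Fin n), ℂ)) :
    sobNorm δ 0 (smulLeftCLM ℂ χ v) ≤ (c 0).toNNReal * localL2 B v := by
  rw [sobNorm_order_zero]
  have h1 : Function.support (smulLeftCLM ℂ χ v) ⊆ B := by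
    intro x hx
    by_contra hx'
    rw [Function.mem_support, smulLeftCLM_apply_apply (h.hasTemperateGrowth hδ),
      h.eq_zero hx'] at hx
    simp at hx
  rw [← eLpNorm_restrict_eq_of_support_subset h1]
  refine eLpNorm_le_nnreal_smul_eLpNorm_of_ae_le_mul (Filter.Eventually.of_forall fun x => ?_) 2
  rw [← NNReal.coe_le_coe, NNReal.coe_mul, coe_nnnorm, coe_nnnorm,
    smulLeftCLM_apply_apply (h.hasTemperateGrowth hδ), norm_smul]
  gcongr
  exact (h.norm_le x).trans (Real.le_coe_toNNReal _)

/-- `|ξ|^m` is dominated by the symbols of an elliptic system, uniformly in the scale `δ ≤ 1`. -/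
theorem IsElliptic.exists_scaled {P : Fin N → MvPolynomial (Fin n) ℂ} {m : ℕ}
    (hell : IsElliptic P m) : ∃ C : ℝ≥0, ∀ δ : ℝ, 0 < δ → δ ≤ 1 →
      ∀ ξ : EuclideanSpace ℝ (Fin n),
        (1 + δ * ‖ξ‖) ^ m ≤ C * (1 + δ ^ m * ∑ j, ‖fourierSymbol (P j) ξ‖) := by
  obtain ⟨C, hC, h⟩ := hell
  refine ⟨(2 ^ m * (1 + C)).toNNReal, fun δ hδ hδ1 ξ => ?_⟩
  have h1 := h ((2 * Real.pi) • ξ)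
  have h2 : ‖ξ‖ ≤ ‖(2 * Real.pi) • ξ‖ := by
    rw [norm_smul, Real.norm_of_nonneg (by positivity)]
    exact le_mul_of_one_le_left (norm_nonneg _) (by nlinarith [Real.pi_gt_three])
  have h3 : ‖ξ‖ ^ m ≤ C * (1 + ∑ j, ‖fourierSymbol (P j) ξ‖) :=
    (pow_le_pow_left₀ (norm_nonneg _) h2 m).trans h1
  set S := ∑ j, ‖fourierSymbol (P j) ξ‖ with hS
  have hS0 : 0 ≤ S := Finset.sum_nonneg fun _ _ => norm_nonneg _
  have hδm : δ ^ m ≤ 1 := pow_le_one₀ hδ.le hδ1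
  have hδm0 : 0 < δ ^ m := by positivity
  have h4 : (1 + δ * ‖ξ‖) ^ m ≤ 2 ^ m * (1 + δ ^ m * ‖ξ‖ ^ m) := by
    have h6 : 0 ≤ δ * ‖ξ‖ := by positivity
    rw [← mul_pow]
    rcases le_total (δ * ‖ξ‖) 1 with h5 | h5
    · calc (1 + δ * ‖ξ‖) ^ m ≤ 2 ^ m := pow_le_pow_left₀ (by positivity) (by linarith) m
        _ = 2 ^ m * (1 + 0) := by ring
        _ ≤ _ := by gcongr; positivity
    · calc (1 + δ * ‖ξ‖) ^ m ≤ (2 * (δ * ‖ξ‖)) ^ m :=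
            pow_le_pow_left₀ (by positivity) (by linarith) m
        _ = 2 ^ m * (0 + (δ * ‖ξ‖) ^ m) := by rw [mul_pow]; ring
        _ ≤ _ := by gcongr; exact zero_le_one
  rw [Real.coe_toNNReal _ (by positivity)]
  refine h4.trans ?_
  rw [mul_assoc]
  gcongr
  calc 1 + δ ^ m * ‖ξ‖ ^ m ≤ 1 + δ ^ m * (C * (1 + S)) := by gcongr
    _ = 1 + C * δ ^ m + C * (δ ^ m * S) := by ring
    _ ≤ 1 + C * 1 + (1 + C) * (δ ^ m * S) := by gcongr; linarith
    _ = _ := by ring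

/-- Ellipticity on the Fourier side. The order `s - m` on the right is nonpositive, so that the
last terms are weaker than `L²` norms. -/
theorem sobNorm_le_of_elliptic {P : Fin N → MvPolynomial (Fin n) ℂ} {m : ℕ}
    (hell : IsElliptic P m) : ∃ C : ℝ≥0, ∀ δ : ℝ, 0 < δ → δ ≤ 1 → ∀ s : ℤ, s ≤ m →
      ∀ w : 𝓢(EuclideanSpace ℝ (Fin n), ℂ),
        sobNorm δ s w ≤ C * (sobNorm δ 0 w +
          ∑ j, ENNReal.ofReal (δ ^ m) * sobNorm δ (s - m) (polyOp (P j) w)) := by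
  obtain ⟨C, hC⟩ := hell.exists_scaled
  refine ⟨C, fun δ hδ hδ1 s hs w => ?_⟩
  have key : ∀ ξ, (1 + δ * ‖ξ‖) ^ s * ‖𝓕 w ξ‖ ≤ C * ((1 + δ * ‖ξ‖) ^ (0 : ℤ) * ‖𝓕 w ξ‖ +
      ∑ j, δ ^ m * ((1 + δ * ‖ξ‖) ^ (s - m) * ‖𝓕 (polyOp (P j) w) ξ‖)) := by
    intro ξ
    have h0 : 0 < 1 + δ * ‖ξ‖ := by positivity
    have h1 := hC δ hδ hδ1 ξ
    have h2 : (1 + δ * ‖ξ‖) ^ s = (1 + δ * ‖ξ‖) ^ (s - m) * (1 + δ * ‖ξ‖) ^ m := by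
      rw [← zpow_natCast, ← zpow_add₀ h0.ne']; congr 1; ring
    have h3 : (1 + δ * ‖ξ‖) ^ (s - m) ≤ 1 :=
      zpow_le_one_of_nonpos₀ (le_add_of_nonneg_right (by positivity)) (by omega)
    have h4 : ∑ j, δ ^ m * ((1 + δ * ‖ξ‖) ^ (s - m) * ‖𝓕 (polyOp (P j) w) ξ‖) =
        (1 + δ * ‖ξ‖) ^ (s - m) * (δ ^ m * ∑ j, ‖fourierSymbol (P j) ξ‖) * ‖𝓕 w ξ‖ := by
      simp only [fourier_polyOp, norm_mul, Finset.mul_sum, Finset.sum_mul]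
      exact Finset.sum_congr rfl fun j _ => by ring
    rw [h4, h2, zpow_zero]
    calc _ ≤ (1 + δ * ‖ξ‖) ^ (s - m) * (C * (1 + δ ^ m * ∑ j, ‖fourierSymbol (P j) ξ‖)) *
          ‖𝓕 w ξ‖ := by gcongr
      _ = C * ((1 + δ * ‖ξ‖) ^ (s - m) * ‖𝓕 w ξ‖ +
          (1 + δ * ‖ξ‖) ^ (s - m) * (δ ^ m * ∑ j, ‖fourierSymbol (P j) ξ‖) * ‖𝓕 w ξ‖) := by ring
      _ ≤ _ := by gcongr
  let g : EuclideanSpace ℝ (Fin n) → ℝ := fun ξ => (1 + δ * ‖ξ‖) ^ (0 : ℤ) * ‖𝓕 w ξ‖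
  let f : Fin N → EuclideanSpace ℝ (Fin n) → ℝ := fun j =>
    (δ ^ m) • fun ξ => (1 + δ * ‖ξ‖) ^ (s - m) * ‖𝓕 (polyOp (P j) w) ξ‖
  have hf : ∀ j, AEStronglyMeasurable (f j) volume := fun j =>
    (measurable_sobNorm_integrand δ (s - m) (polyOp (P j) w)).const_smul _
  have hfn : ∀ j, eLpNorm (f j) 2 volume =
      ENNReal.ofReal (δ ^ m) * sobNorm δ (s - m) (polyOp (P j) w) := fun j => by
    rw [eLpNorm_const_smul, sobNorm, ← ofReal_norm, Real.norm_of_nonneg (by positivity)]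
  have hg : AEStronglyMeasurable g volume := measurable_sobNorm_integrand δ 0 w
  calc sobNorm δ s w ≤ C * eLpNorm (g + ∑ j, f j) 2 volume := by
        refine eLpNorm_le_nnreal_smul_eLpNorm_of_ae_le_mul
          (Filter.Eventually.of_forall fun ξ => ?_) 2
        rw [← NNReal.coe_le_coe, NNReal.coe_mul, coe_nnnorm, coe_nnnorm,
          Real.norm_of_nonneg (by positivity)]
        refine (key ξ).trans ?_
        gcongr
        refine le_trans (le_of_eq ?_) (le_abs_self _)
        simp [g, f]
    _ ≤ C * (eLpNorm g 2 volume + ∑ j, eLpNorm (f j) 2 volume) := by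
        refine mul_le_mul_right ((eLpNorm_add_le hg
          (Finset.aestronglyMeasurable_sum _ fun j _ => hf j) (by norm_num)).trans ?_) _
        gcongr
        exact eLpNorm_sum_le (fun j _ => hf j) (by norm_num)
    _ = _ := by simp only [hfn]; rfl

/-- The commutator of a derivative `D_{i_1} ⋯ D_{i_k}` with the multiplication by `χ`. -/
noncomputable def comm (χ : EuclideanSpace ℝ (Fin n) → ℂ) (l : List (Fin n))
    (v : 𝓢(EuclideanSpace ℝ (Fin n), ℂ)) : 𝓢(EuclideanSpace ℝ (Fin n), ℂ) :=
  listD l (smulLeftCLM ℂ χ v) - smulLeftCLM ℂ χ (listD l v)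

/-- The recursion behind the commutator estimate:
`[D_i D_l, χ] = D_i [D_l, χ] + D_l (D_i χ) - [D_l, D_i χ]`, multiplied by `δ` so that only scaled
cutoff functions occur. -/
theorem smul_comm_cons {c : ℕ → ℝ} {δ : ℝ} {B : Set (EuclideanSpace ℝ (Fin n))}
    {χ : EuclideanSpace ℝ (Fin n) → ℂ} (h : IsScaledCutoff c δ B χ) (hδ : 0 < δ)
    (i : Fin n) (l : List (Fin n)) (v : 𝓢(EuclideanSpace ℝ (Fin n), ℂ)) :
    (δ : ℂ) • comm χ (i :: l) v = (δ : ℂ) • polyOp (MvPolynomial.X i) (comm χ l v) +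
      (listD l (smulLeftCLM ℂ ((δ : ℂ) • partialD i χ) v) -
        comm ((δ : ℂ) • partialD i χ) l v) := by
  have hχ := h.hasTemperateGrowth hδ
  have hχ' := (h.smul_partialD hδ i).hasTemperateGrowth hδ
  have hχ'' : (partialD i χ).HasTemperateGrowth := by
    have := (Function.HasTemperateGrowth.const ((δ : ℂ)⁻¹)).mul hχ'
    have e : partialD i χ = (fun _ => (δ : ℂ)⁻¹) * ((δ : ℂ) • partialD i χ) := by
      funext x
      have : (δ : ℂ) ≠ 0 := by exact_mod_cast hδ.ne'
      simp [this]
    rwa [e]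
  have e1 : smulLeftCLM ℂ ((δ : ℂ) • partialD i χ) (listD l v) =
      (δ : ℂ) • smulLeftCLM ℂ (partialD i χ) (listD l v) := by
    rw [smulLeftCLM_smul hχ'']; rfl
  rw [comm, comm, comm, listD_cons, listD_cons, map_sub,
    polyOp_X_smulLeftCLM i hχ hχ'', sub_sub_cancel, e1, ← smul_add]
  congr 1
  abel

/-- The assertion that the scaled Sobolev norm of order `s` of `χ v` is controlled by the graph
norm of `v` on the support of `χ`, uniformly in the scale and in classes of cutoff functions. -/
def CutoffEstimate (P : Fin N → MvPolynomial (Fin n) ℂ) (m : ℕ) (s : ℤ) : Prop :=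
  ∀ c : ℕ → ℝ, ∃ C : ℝ≥0, ∀ (δ : ℝ) (B : Set (EuclideanSpace ℝ (Fin n)))
    (χ : EuclideanSpace ℝ (Fin n) → ℂ) (v : 𝓢(EuclideanSpace ℝ (Fin n), ℂ)),
    0 < δ → δ ≤ 1 → IsScaledCutoff c δ B χ →
      sobNorm δ s (smulLeftCLM ℂ χ v) ≤ C * graphNorm P m δ B v

/-- Commutators with cutoff functions gain one order. -/
theorem CutoffEstimate.comm_le {P : Fin N → MvPolynomial (Fin n) ℂ} {m : ℕ} {s : ℤ}
    (hs : CutoffEstimate P m s) (l : List (Fin n)) : ∀ c : ℕ → ℝ, ∃ C : ℝ≥0,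
    ∀ (δ : ℝ) (B : Set (EuclideanSpace ℝ (Fin n)))
    (χ : EuclideanSpace ℝ (Fin n) → ℂ) (v : 𝓢(EuclideanSpace ℝ (Fin n), ℂ)),
    0 < δ → δ ≤ 1 → IsScaledCutoff c δ B χ →
      ENNReal.ofReal (δ ^ l.length) * sobNorm δ (s + 1 - l.length) (comm χ l v) ≤
        C * graphNorm P m δ B v := by
  induction l with
  | nil =>
    intro c
    refine ⟨0, fun δ B χ v _ _ _ => ?_⟩
    simp [comm, listD_nil, sobNorm_zero_right]
  | cons i l ih =>
    intro c
    obtain ⟨C₁, h₁⟩ := ih c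
    obtain ⟨C₂, h₂⟩ := hs (fun k => c (k + 1))
    obtain ⟨C₃, h₃⟩ := ih (fun k => c (k + 1))
    refine ⟨(2 * Real.pi).toNNReal * C₁ + (((2 * Real.pi) ^ l.length).toNNReal * C₂ + C₃),
      fun δ B χ v hδ hδ1 hχ => ?_⟩
    have hχ' := hχ.smul_partialD hδ i
    have h0 : ENNReal.ofReal δ = ‖(δ : ℂ)‖ₑ := by
      rw [← ofReal_norm, Complex.norm_real, Real.norm_of_nonneg hδ.le]
    set s' : ℤ := s + 1 - (i :: l).length with hs'
    have hs1 : s' + 1 = s + 1 - l.length := by rw [hs', List.length_cons]; push_cast; ring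
    have hs2 : s' + l.length = s := by rw [hs', List.length_cons]; push_cast; ring
    set X := graphNorm P m δ B v
    set d := ENNReal.ofReal (δ ^ l.length)
    have t1 : d * sobNorm δ s' ((δ : ℂ) • polyOp (MvPolynomial.X i) (comm χ l v)) ≤
        ENNReal.ofReal (2 * Real.pi) * (C₁ * X) := by
      rw [sobNorm_smul, ← h0]
      refine (mul_le_mul_right (sobNorm_polyOp_X_le hδ.le s' i _) _).trans ?_
      rw [hs1, mul_left_comm]
      exact mul_le_mul_right (h₁ δ B χ v hδ hδ1 hχ) _
    have t2 : d * sobNorm δ s' (listD l (smulLeftCLM ℂ ((δ : ℂ) • partialD i χ) v)) ≤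
        ENNReal.ofReal ((2 * Real.pi) ^ l.length) * (C₂ * X) := by
      refine (sobNorm_listD_le hδ.le l s' _).trans ?_
      rw [hs2]
      exact mul_le_mul_right (h₂ δ B _ v hδ hδ1 hχ') _
    have t3 : d * sobNorm δ s' (comm ((δ : ℂ) • partialD i χ) l v) ≤ C₃ * X := by
      refine le_trans ?_ (h₃ δ B _ v hδ hδ1 hχ')
      rw [← hs1]
      exact mul_le_mul_right (sobNorm_mono hδ.le (by omega) _) _
    have e : ENNReal.ofReal (δ ^ (i :: l).length) * sobNorm δ s' (comm χ (i :: l) v) =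
        d * sobNorm δ s' ((δ : ℂ) • comm χ (i :: l) v) := by
      rw [sobNorm_smul, ← h0, List.length_cons, pow_succ, ENNReal.ofReal_mul (by positivity)]
      ring
    rw [e, smul_comm_cons hχ hδ]
    calc _ ≤ d * (sobNorm δ s' ((δ : ℂ) • polyOp (MvPolynomial.X i) (comm χ l v)) +
          (sobNorm δ s' (listD l (smulLeftCLM ℂ ((δ : ℂ) • partialD i χ) v)) +
          sobNorm δ s' (comm ((δ : ℂ) • partialD i χ) l v))) := by
          refine mul_le_mul_right ((sobNorm_add_le δ hδ.le _ _ _).trans ?_) _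
          gcongr
          exact sobNorm_sub_le δ hδ.le _ _ _
      _ = _ := by rw [mul_add, mul_add]
      _ ≤ ENNReal.ofReal (2 * Real.pi) * (C₁ * X) +
          (ENNReal.ofReal ((2 * Real.pi) ^ l.length) * (C₂ * X) + C₃ * X) := by gcongr
      _ = _ := by
        push_cast
        simp only [ENNReal.ofReal]
        ring

theorem CutoffEstimate.zero (P : Fin N → MvPolynomial (Fin n) ℂ) (m : ℕ) :
    CutoffEstimate P m 0 := by
  intro c
  refine ⟨(c 0).toNNReal, fun δ B χ v hδ _ hχ => ?_⟩
  refine (sobNorm_zero_smulLeftCLM_le hχ hδ v).trans ?_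
  exact mul_le_mul_right le_self_add _

/-- The commutator of `p(D)` with a cutoff function. -/
theorem CutoffEstimate.comm_polyOp_le {P : Fin N → MvPolynomial (Fin n) ℂ} {m : ℕ} {s : ℤ}
    (hs : CutoffEstimate P m s) (p : MvPolynomial (Fin n) ℂ) (hp : p.totalDegree ≤ m)
    (c : ℕ → ℝ) : ∃ C : ℝ≥0,
    ∀ (δ : ℝ) (B : Set (EuclideanSpace ℝ (Fin n)))
    (χ : EuclideanSpace ℝ (Fin n) → ℂ) (v : 𝓢(EuclideanSpace ℝ (Fin n), ℂ)),
    0 < δ → δ ≤ 1 → IsScaledCutoff c δ B χ →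
      ENNReal.ofReal (δ ^ m) * sobNorm δ (s + 1 - m)
        (polyOp p (smulLeftCLM ℂ χ v) - smulLeftCLM ℂ χ (polyOp p v)) ≤
        C * graphNorm P m δ B v := by
  choose l hl hl' using exists_list_monomial (n := n)
  choose C hC using fun α => hs.comm_le (l α) c
  refine ⟨∑ α ∈ p.support, ‖p.coeff α‖₊ * C α, fun δ B χ v hδ hδ1 hχ => ?_⟩
  have e : polyOp p (smulLeftCLM ℂ χ v) - smulLeftCLM ℂ χ (polyOp p v) =
      ∑ α ∈ p.support, p.coeff α • comm χ (l α) v := by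
    rw [polyOp_eq_sum, polyOp_eq_sum p v, map_sum, ← Finset.sum_sub_distrib]
    refine Finset.sum_congr rfl fun α _ => ?_
    rw [map_smul, ← smul_sub, comm, listD, ← hl']
  rw [e]
  push_cast
  rw [Finset.sum_mul]
  refine (mul_le_mul_right (sobNorm_sum_le δ hδ.le _ _ _) _).trans ?_
  rw [Finset.mul_sum]
  refine Finset.sum_le_sum fun α hα => ?_
  have hα' : (l α).length ≤ m := by
    rw [hl]
    exact (MvPolynomial.le_totalDegree hα).trans hp
  rw [sobNorm_smul, mul_left_comm, mul_assoc, ← enorm_eq_nnnorm]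
  refine mul_le_mul_right (le_trans ?_ (hC α δ B χ v hδ hδ1 hχ)) _
  refine mul_le_mul' (ENNReal.ofReal_le_ofReal ?_) (sobNorm_mono hδ.le (by omega) _)
  exact pow_le_pow_of_le_one hδ.le hδ1 hα'

/-- One order is gained from ellipticity: `P_j(D)(χ v) = χ P_j(D) v + [P_j(D), χ] v`, and the
commutator is controlled by the estimate of order `s` for derivatives of `χ`. -/
theorem CutoffEstimate.succ {P : Fin N → MvPolynomial (Fin n) ℂ} {m : ℕ} {s : ℤ}
    (hs : CutoffEstimate P m s) (hP : ∀ j, (P j).totalDegree ≤ m) (hell : IsElliptic P m)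
    (hsm : s + 1 ≤ m) : CutoffEstimate P m (s + 1) := by
  intro c
  obtain ⟨C₀, h₀⟩ := sobNorm_le_of_elliptic hell
  choose C hC using fun j => hs.comm_polyOp_le (P j) (hP j) c
  refine ⟨C₀ * ((c 0).toNNReal + ∑ j, C j), fun δ B χ v hδ hδ1 hχ => ?_⟩
  refine (h₀ δ hδ hδ1 (s + 1) hsm _).trans ?_
  push_cast
  rw [mul_assoc]
  refine mul_le_mul_right ?_ _
  have h1 : ∀ j, ENNReal.ofReal (δ ^ m) *
      sobNorm δ (s + 1 - m) (polyOp (P j) (smulLeftCLM ℂ χ v)) ≤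
      (c 0).toNNReal * (ENNReal.ofReal (δ ^ m) * localL2 B (polyOp (P j) v)) +
        C j * graphNorm P m δ B v := by
    intro j
    rw [← add_sub_cancel (smulLeftCLM ℂ χ (polyOp (P j) v))
      (polyOp (P j) (smulLeftCLM ℂ χ v))]
    refine (mul_le_mul_right (sobNorm_add_le δ hδ.le _ _ _) _).trans ?_
    rw [mul_add]
    refine add_le_add ?_ (hC j δ B χ v hδ hδ1 hχ)
    rw [mul_left_comm]
    refine mul_le_mul_right ?_ _
    exact (sobNorm_mono hδ.le (by omega) _).trans (sobNorm_zero_smulLeftCLM_le hχ hδ _)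
  refine (add_le_add (sobNorm_zero_smulLeftCLM_le hχ hδ v)
    (Finset.sum_le_sum fun j _ => h1 j)).trans (le_of_eq ?_)
  rw [Finset.sum_add_distrib, ← add_assoc, ← Finset.mul_sum, ← Finset.mul_sum, ← mul_add,
    ← Finset.sum_mul, add_mul]
  rfl

/-- Elliptic regularity for cutoffs: all orders up to the order of the system are controlled. -/
theorem cutoffEstimate {P : Fin N → MvPolynomial (Fin n) ℂ} {m : ℕ}
    (hP : ∀ j, (P j).totalDegree ≤ m) (hell : IsElliptic P m) (s : ℕ) (hs : s ≤ m) :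
    CutoffEstimate P m s := by
  induction s with
  | zero => exact CutoffEstimate.zero P m
  | succ s ih =>
    have := (ih (by omega)).succ hP hell (by exact_mod_cast hs)
    exact_mod_cast this

/-- The interior estimate: if a cutoff function supported in `B` equals `1` on `A`, then on `A` the
derivatives of order at most `m` are controlled by the graph norm on `B`. -/
theorem localL2_listD_le {P : Fin N → MvPolynomial (Fin n) ℂ} {m : ℕ}
    (hP : ∀ j, (P j).totalDegree ≤ m) (hell : IsElliptic P m) (l : List (Fin n))
    (hl : l.length ≤ m) (c : ℕ → ℝ) : ∃ C : ℝ≥0, ∀ (δ : ℝ) (A B : Set (EuclideanSpace ℝ (Fin n)))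
    (χ : EuclideanSpace ℝ (Fin n) → ℂ) (v : 𝓢(EuclideanSpace ℝ (Fin n), ℂ)),
    0 < δ → δ ≤ 1 → IsScaledCutoff c δ B χ → MeasurableSet A → (∀ x ∈ A, χ x = 1) →
      ENNReal.ofReal (δ ^ l.length) * localL2 A (listD l v) ≤ C * graphNorm P m δ B v := by
  obtain ⟨C₁, h₁⟩ := cutoffEstimate hP hell l.length hl c
  obtain ⟨C₂, h₂⟩ := (cutoffEstimate hP hell m le_rfl).comm_le l c
  refine ⟨((2 * Real.pi) ^ l.length).toNNReal * C₁ + C₂, fun δ A B χ v hδ hδ1 hχ hA hA1 => ?_⟩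
  have e1 : localL2 A (listD l v) ≤ sobNorm δ 0 (smulLeftCLM ℂ χ (listD l v)) := by
    rw [sobNorm_order_zero, localL2]
    refine le_trans (le_of_eq ?_) (eLpNorm_mono_measure _ (Measure.restrict_le_self (s := A)))
    refine eLpNorm_congr_ae ?_
    filter_upwards [ae_restrict_mem hA] with x hx
    rw [smulLeftCLM_apply_apply (hχ.hasTemperateGrowth hδ), hA1 x hx, one_smul]
  have e2 : smulLeftCLM ℂ χ (listD l v) = listD l (smulLeftCLM ℂ χ v) - comm χ l v := by
    rw [comm, sub_sub_cancel]
  have h3 := sobNorm_listD_le hδ.le l 0 (smulLeftCLM ℂ χ v)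
  rw [zero_add] at h3
  calc _ ≤ ENNReal.ofReal (δ ^ l.length) *
        (sobNorm δ 0 (listD l (smulLeftCLM ℂ χ v)) + sobNorm δ 0 (comm χ l v)) := by
        refine mul_le_mul_right (e1.trans ?_) _
        rw [e2]
        exact sobNorm_sub_le δ hδ.le _ _ _
    _ ≤ ENNReal.ofReal ((2 * Real.pi) ^ l.length) * (C₁ * graphNorm P m δ B v) +
        C₂ * graphNorm P m δ B v := by
        rw [mul_add]
        refine add_le_add (h3.trans (mul_le_mul_right (h₁ δ B χ v hδ hδ1 hχ) _)) ?_
        refine le_trans ?_ (h₂ δ B χ v hδ hδ1 hχ)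
        exact mul_le_mul_right (sobNorm_mono hδ.le (by omega) _) _
    _ = _ := by
        push_cast
        simp only [ENNReal.ofReal]
        ring

/-! ### Cutoff functions for cubes -/

/-- The closed cube with centre `x₀` and half side length `r`. -/
def cube (x₀ : EuclideanSpace ℝ (Fin n)) (r : ℝ) : Set (EuclideanSpace ℝ (Fin n)) :=
  {x | ∀ i, |x i - x₀ i| ≤ r}

theorem isClosed_cube (x₀ : EuclideanSpace ℝ (Fin n)) (r : ℝ) : IsClosed (cube x₀ r) := by
  simp only [cube, Set.ofPred_forall]
  exact isClosed_iInter fun i => isClosed_le (by fun_prop) continuous_const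

/-- All derivatives of the smooth transition function are bounded, although the function itself is
not compactly supported. -/
theorem exists_bound_iteratedFDeriv_smoothTransition (k : ℕ) : ∃ C : ℝ, ∀ t : ℝ,
    ‖iteratedFDeriv ℝ k (fun t => (Real.smoothTransition t : ℂ)) t‖ ≤ C := by
  set T : ℝ → ℂ := fun t => (Real.smoothTransition t : ℂ) with hT
  have hTc : ContDiff ℝ ∞ T := Complex.ofRealCLM.contDiff.comp Real.smoothTransition.contDiff
  cases k with
  | zero =>
    refine ⟨1, fun t => ?_⟩
    rw [norm_iteratedFDeriv_zero, hT, Complex.norm_real,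
      Real.norm_of_nonneg (Real.smoothTransition.nonneg t)]
    exact Real.smoothTransition.le_one t
  | succ k =>
    have hs : HasCompactSupport (fderiv ℝ T) := by
      refine HasCompactSupport.intro (isCompact_Icc (a := (0 : ℝ)) (b := 1)) fun t ht => ?_
      rw [Set.mem_Icc, not_and_or, not_le, not_le] at ht
      rcases ht with ht | ht
      · have : T =ᶠ[nhds t] fun _ => 0 := by
          filter_upwards [gt_mem_nhds ht] with s hs
          simp [hT, Real.smoothTransition.zero_of_nonpos (le_of_lt hs)]
        rw [this.fderiv_eq, fderiv_fun_const]; rfl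
      · have : T =ᶠ[nhds t] fun _ => 1 := by
          filter_upwards [lt_mem_nhds ht] with s hs
          simp [hT, Real.smoothTransition.one_of_one_le (le_of_lt hs)]
        rw [this.fderiv_eq, fderiv_fun_const]; rfl
    have hc : ContDiff ℝ ∞ (fderiv ℝ T) := hTc.fderiv_right (by simp)
    have hg : Continuous fun t => ‖iteratedFDeriv ℝ k (fderiv ℝ T) t‖ :=
      (hc.continuous_iteratedFDeriv (by exact_mod_cast le_top)).norm
    obtain ⟨x₀, hx₀⟩ := hg.exists_forall_ge_of_hasCompactSupport ((hs.iteratedFDeriv _).norm)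
    exact ⟨_, fun t => by rw [← norm_iteratedFDeriv_fderiv]; exact hx₀ t⟩

/-- Products of functions with uniform scaled derivative bounds have uniform scaled bounds. -/
theorem exists_scaled_bound_prod {ι : Type*} (c : ℕ → ℝ) (s : Finset ι) : ∃ c' : ℕ → ℝ,
    ∀ (δ : ℝ) (f : ι → EuclideanSpace ℝ (Fin n) → ℂ), 0 < δ →
      (∀ i, ContDiff ℝ ∞ (f i) ∧ ∀ k x, δ ^ k * ‖iteratedFDeriv ℝ k (f i) x‖ ≤ c k) →
      ContDiff ℝ ∞ (fun x => ∏ i ∈ s, f i x) ∧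
        ∀ k x, δ ^ k * ‖iteratedFDeriv ℝ k (fun x => ∏ i ∈ s, f i x) x‖ ≤ c' k := by
  classical
  induction s using Finset.induction_on with
  | empty =>
    refine ⟨fun k => if k = 0 then 1 else 0, fun δ f hδ _ => ?_⟩
    simp only [Finset.prod_empty]
    refine ⟨contDiff_const, fun k x => ?_⟩
    cases k with
    | zero => simp
    | succ k => simp [iteratedFDeriv_succ_const]
  | insert a s ha ih =>
    obtain ⟨c', h'⟩ := ih
    refine ⟨fun k => ∑ i ∈ Finset.range (k + 1), (k.choose i : ℝ) * c i * c' (k - i),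
      fun δ f hδ hf => ?_⟩
    obtain ⟨h1, h2⟩ := h' δ f hδ hf
    obtain ⟨h3, h4⟩ := hf a
    simp only [Finset.prod_insert ha]
    refine ⟨h3.mul h1, fun k x => ?_⟩
    refine (mul_le_mul_of_nonneg_left (norm_iteratedFDeriv_mul_le h3 h1 x
      (by exact_mod_cast le_top)) (by positivity)).trans ?_
    rw [Finset.mul_sum]
    refine Finset.sum_le_sum fun i hi => ?_
    have hik : i + (k - i) = k := by have := Finset.mem_range.1 hi; omega
    calc _ = (k.choose i : ℝ) * (δ ^ i * ‖iteratedFDeriv ℝ i (f a) x‖) *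
          (δ ^ (k - i) * ‖iteratedFDeriv ℝ (k - i) (fun x => ∏ i ∈ s, f i x) x‖) := by
          conv_lhs => rw [← hik, pow_add, hik]
          ring
      _ ≤ _ := by
          have h5 := h4 i x
          have h6 := h2 (k - i) x
          have h7 : 0 ≤ c i := le_trans (by positivity) h5
          gcongr

/-- Cutoff functions with transition region of width `δ` exist on all cubes, with uniform bounds. -/
theorem exists_isScaledCutoff_cube (n : ℕ) : ∃ c : ℕ → ℝ, ∀ (δ r : ℝ)
    (x₀ : EuclideanSpace ℝ (Fin n)), 0 < δ → ∃ χ : EuclideanSpace ℝ (Fin n) → ℂ,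
      IsScaledCutoff c δ (cube x₀ (r + δ)) χ ∧ ∀ x ∈ cube x₀ r, χ x = 1 := by
  choose C hC using exists_bound_iteratedFDeriv_smoothTransition
  obtain ⟨c, hc⟩ := exists_scaled_bound_prod (n := n) C (Finset.univ : Finset (Fin n × Bool))
  refine ⟨c, fun δ r x₀ hδ => ?_⟩
  let σ : Bool → ℝ := fun b => if b then 1 else -1
  let f : Fin n × Bool → EuclideanSpace ℝ (Fin n) → ℂ := fun p x =>
    (Real.smoothTransition ((r + δ + σ p.2 * (x p.1 - x₀ p.1)) / δ) : ℂ)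
  have hσ : ∀ b, |σ b| = 1 := by intro b; cases b <;> simp [σ]
  obtain ⟨h1, h2⟩ := hc δ f hδ (by
    intro p
    let g : ℝ → ℂ := fun t => (Real.smoothTransition ((r + δ - σ p.2 * x₀ p.1) / δ + t) : ℂ)
    let ℓ : EuclideanSpace ℝ (Fin n) →L[ℝ] ℝ := (σ p.2 / δ) • EuclideanSpace.proj p.1
    have hT : ContDiff ℝ ∞ (fun t => (Real.smoothTransition t : ℂ)) :=
      Complex.ofRealCLM.contDiff.comp Real.smoothTransition.contDiff
    have hg : ContDiff ℝ ∞ g := hT.comp (contDiff_const.add contDiff_id)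
    have hfg : f p = g ∘ ℓ := by
      ext x
      have h3 : ℓ x = σ p.2 / δ * x p.1 := rfl
      simp only [f, g, Function.comp_apply, h3]
      congr 2
      field_simp
      ring
    have hℓ : ‖ℓ‖ ≤ 1 / δ := by
      refine ContinuousLinearMap.opNorm_le_bound _ (by positivity) fun x => ?_
      have h3 : ℓ x = σ p.2 / δ * x p.1 := rfl
      simp only [h3, norm_mul, norm_div, Real.norm_eq_abs, hσ, abs_of_pos hδ]
      gcongr
      exact PiLp.norm_apply_le x p.1
    rw [hfg]
    refine ⟨hg.comp ℓ.contDiff, fun k x => ?_⟩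
    rw [ContinuousLinearMap.iteratedFDeriv_comp_right ℓ hg x (by exact_mod_cast le_top)]
    have h3 : ‖iteratedFDeriv ℝ k g (ℓ x)‖ ≤ C k := by
      exact (congrArg norm (iteratedFDeriv_comp_add_left (𝕜 := ℝ)
        (f := fun t => (Real.smoothTransition t : ℂ)) k _ _)).trans_le (hC k _)
    have h4 : 0 ≤ C k := (norm_nonneg _).trans h3
    calc _ ≤ δ ^ k * (C k * (1 / δ) ^ k) := by
          refine mul_le_mul_of_nonneg_left
            ((ContinuousMultilinearMap.norm_compContinuousLinearMap_le _ _).trans ?_)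
            (by positivity)
          rw [Finset.prod_const, Finset.card_univ, Fintype.card_fin]
          gcongr
      _ = C k := by rw [one_div, inv_pow]; field_simp)
  refine ⟨_, ⟨h1, h2, ?_⟩, fun x hx => ?_⟩
  · refine closure_minimal (fun x hx i => ?_) (isClosed_cube _ _)
    have h3 : ∀ b, 0 < (r + δ + σ b * (x i - x₀ i)) / δ := by
      intro b
      by_contra h
      exact hx (Finset.prod_eq_zero (Finset.mem_univ (i, b))
        (by simp [f, Real.smoothTransition.zero_of_nonpos (not_lt.1 h)]))
    have h4 := h3 true
    have h5 := h3 false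
    rw [lt_div_iff₀ hδ] at h4 h5
    simp only [σ] at h4 h5
    rw [abs_le]
    constructor <;> norm_num at h4 h5 <;> linarith
  · refine Finset.prod_eq_one fun p _ => ?_
    have h3 : 1 ≤ (r + δ + σ p.2 * (x p.1 - x₀ p.1)) / δ := by
      rw [le_div_iff₀ hδ]
      have h4 := hx p.1
      have h5 : |σ p.2 * (x p.1 - x₀ p.1)| ≤ r := by rwa [abs_mul, hσ, one_mul]
      have := (abs_le.1 h5).1
      linarith
    simp [f, Real.smoothTransition.one_of_one_le h3]

/-! ### Iterating the interior estimate -/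

theorem prod_pow_add_single (P : Fin N → MvPolynomial (Fin n) ℂ) (β : Fin N → ℕ) (j : Fin N) :
    ∏ i, P i ^ (β + Pi.single j 1 : Fin N → ℕ) i = (∏ i, P i ^ β i) * P j := by
  simp only [Pi.add_apply, pow_add, Finset.prod_mul_distrib]
  congr 1
  rw [Finset.prod_eq_single j] <;> simp +contextual

theorem exists_localL2_listD_le_cube {P : Fin N → MvPolynomial (Fin n) ℂ} {m : ℕ}
    (hP : ∀ j, (P j).totalDegree ≤ m) (hell : IsElliptic P m) : ∃ C : ℝ≥0,
    ∀ (δ r : ℝ) (x₀ : EuclideanSpace ℝ (Fin n)) (v : 𝓢(EuclideanSpace ℝ (Fin n), ℂ))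
      (l : List (Fin n)), 0 < δ → δ ≤ 1 → l.length ≤ m →
      ENNReal.ofReal (δ ^ l.length) * localL2 (cube x₀ r) (listD l v) ≤
        C * graphNorm P m δ (cube x₀ (r + δ)) v := by
  obtain ⟨c, hc⟩ := exists_isScaledCutoff_cube n
  have hfin : {l : List (Fin n) | l.length ≤ m}.Finite := List.finite_length_le _ _
  choose! C hC using fun (l : List (Fin n)) (hl : l.length ≤ m) => localL2_listD_le hP hell l hl c
  refine ⟨∑ l ∈ hfin.toFinset, C l, fun δ r x₀ v l hδ hδ1 hl => ?_⟩
  obtain ⟨χ, h1, h2⟩ := hc δ r x₀ hδ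
  refine (hC l hl δ _ _ χ v hδ hδ1 h1 (isClosed_cube _ _).measurableSet h2).trans ?_
  gcongr
  exact Finset.single_le_sum (f := C) (fun _ _ => zero_le) (hfin.mem_toFinset.2 hl)

/-- Iterating the interior estimate `k` times on cubes that grow by `δ` at each step: derivatives
of order at most `mk` are controlled by the iterates `P^β` with `|β| ≤ k`. -/
theorem exists_localL2_listD_le_iterate {P : Fin N → MvPolynomial (Fin n) ℂ} {m : ℕ}
    (hP : ∀ j, (P j).totalDegree ≤ m) (hell : IsElliptic P m) : ∃ C : ℝ≥0,
    ∀ (δ : ℝ) (x₀ : EuclideanSpace ℝ (Fin n)), 0 < δ → δ ≤ 1 →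
      ∀ (k : ℕ) (r : ℝ) (v : 𝓢(EuclideanSpace ℝ (Fin n), ℂ)) (Q : ℝ≥0∞) (l : List (Fin n)),
        l.length ≤ m * k →
        (∀ β : Fin N → ℕ, ∑ j, β j ≤ k → ENNReal.ofReal (δ ^ (m * ∑ j, β j)) *
          localL2 (cube x₀ (r + k * δ)) (polyOp (∏ j, P j ^ β j) v) ≤ Q) →
        ENNReal.ofReal (δ ^ l.length) * localL2 (cube x₀ r) (listD l v) ≤ (C : ℝ≥0∞) ^ k * Q := by
  obtain ⟨C, hC⟩ := exists_localL2_listD_le_cube hP hell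
  refine ⟨C * (1 + N), fun δ x₀ hδ hδ1 k => ?_⟩
  induction k with
  | zero =>
    intro r v Q l hl h
    have hl0 : l = [] := List.length_eq_zero_iff.1 (by omega)
    have := h 0 (by simp)
    simpa [hl0, listD_nil, polyOp_one] using this
  | succ k ih =>
    intro r v Q l hl h
    set l₁ := l.take m
    set l₂ := l.drop m
    have hl12 : l = l₁ ++ l₂ := (List.take_append_drop m l).symm
    have hl1 : l₁.length ≤ m := by simp [l₁]
    have hl2 : l₂.length ≤ m * k := by
      simp only [l₂, List.length_drop]; rw [mul_add] at hl; omega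
    have hr : r + ((k + 1 : ℕ) : ℝ) * δ = r + δ + k * δ := by push_cast; ring
    rw [hr] at h
    have hδm : ENNReal.ofReal (δ ^ m) ≠ 0 := by
      rw [Ne, ENNReal.ofReal_eq_zero, not_le]; positivity
    have i1 : ENNReal.ofReal (δ ^ l₂.length) * localL2 (cube x₀ (r + δ)) (listD l₂ v) ≤
        ((C * (1 + N) : ℝ≥0) : ℝ≥0∞) ^ k * Q :=
      ih (r + δ) v Q l₂ hl2 fun β hβ => h β (by omega)
    have i2 : ∀ j, ENNReal.ofReal (δ ^ l₂.length) * (ENNReal.ofReal (δ ^ m) *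
        localL2 (cube x₀ (r + δ)) (polyOp (P j) (listD l₂ v))) ≤
        ((C * (1 + N) : ℝ≥0) : ℝ≥0∞) ^ k * Q := by
      intro j
      have := ih (r + δ) (polyOp (P j) v) (Q / ENNReal.ofReal (δ ^ m)) l₂ hl2 fun β hβ => by
        rw [ENNReal.le_div_iff_mul_le (Or.inl hδm) (Or.inl ENNReal.ofReal_ne_top)]
        have hs : ∑ i, (β + Pi.single j 1 : Fin N → ℕ) i = ∑ i, β i + 1 := by
          simp [Finset.sum_add_distrib]
        have h1 := h (β + Pi.single j 1) (by rw [hs]; omega)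
        rw [hs, prod_pow_add_single, polyOp_mul, mul_add, mul_one, pow_add,
          ENNReal.ofReal_mul (by positivity)] at h1
        calc _ = _ := by ring
          _ ≤ _ := h1
      rw [← mul_div_assoc, ENNReal.le_div_iff_mul_le (Or.inl hδm)
        (Or.inl ENNReal.ofReal_ne_top)] at this
      refine le_trans (le_of_eq ?_) this
      rw [listD, polyOp_comm]
      ring
    have i3 := hC δ r x₀ (listD l₂ v) l₁ hδ hδ1 hl1
    rw [hl12, listD_append, List.length_append, pow_add, ENNReal.ofReal_mul (by positivity)]
    calc _ = ENNReal.ofReal (δ ^ l₂.length) * (ENNReal.ofReal (δ ^ l₁.length) *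
          localL2 (cube x₀ r) (listD l₁ (listD l₂ v))) := by ring
      _ ≤ ENNReal.ofReal (δ ^ l₂.length) *
          (C * graphNorm P m δ (cube x₀ (r + δ)) (listD l₂ v)) := mul_le_mul_right i3 _
      _ = C * (ENNReal.ofReal (δ ^ l₂.length) * localL2 (cube x₀ (r + δ)) (listD l₂ v) +
          ∑ j, ENNReal.ofReal (δ ^ l₂.length) * (ENNReal.ofReal (δ ^ m) *
            localL2 (cube x₀ (r + δ)) (polyOp (P j) (listD l₂ v)))) := by
          rw [graphNorm, ← Finset.mul_sum, ← Finset.mul_sum]; ring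
      _ ≤ C * (((C * (1 + N) : ℝ≥0) : ℝ≥0∞) ^ k * Q +
          ∑ _j : Fin N, ((C * (1 + N) : ℝ≥0) : ℝ≥0∞) ^ k * Q) := by
          exact mul_le_mul_right (add_le_add i1 (Finset.sum_le_sum fun j _ => i2 j)) _
      _ = _ := by
          rw [Finset.sum_const, Finset.card_univ, Fintype.card_fin, nsmul_eq_mul]
          push_cast
          ring

/-! ### A Sobolev inequality -/

/-- The system `(D_1^M, …, D_n^M)` is elliptic. Its interior estimate is used to deduce the Sobolev
inequality. -/
theorem isElliptic_X_pow (M : ℕ) (hM : M ≠ 0) :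
    IsElliptic (fun i : Fin n => (MvPolynomial.X i : MvPolynomial (Fin n) ℂ) ^ M) M := by
  refine ⟨(n : ℝ) ^ M + 1, by positivity, fun ξ => ?_⟩
  simp only [map_pow, MvPolynomial.eval_X, norm_pow, Complex.norm_real]
  rcases Nat.eq_zero_or_pos n with rfl | hn
  · have : ξ = 0 := Subsingleton.elim _ _
    simp [this, hM]
  · have : Nonempty (Fin n) := ⟨⟨0, hn⟩⟩
    obtain ⟨i, hi⟩ := Finite.exists_max fun i => ‖ξ i‖
    have h1 : ‖ξ‖ ≤ n * ‖ξ i‖ := by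
      rw [EuclideanSpace.norm_eq]
      refine Real.sqrt_le_iff.2 ⟨by positivity, ?_⟩
      calc ∑ j, ‖ξ j‖ ^ 2 ≤ ∑ _j : Fin n, ‖ξ i‖ ^ 2 :=
            Finset.sum_le_sum fun j _ => pow_le_pow_left₀ (norm_nonneg _) (hi j) 2
        _ = n * ‖ξ i‖ ^ 2 := by simp
        _ ≤ n ^ 2 * ‖ξ i‖ ^ 2 := by
            gcongr
            have : (1 : ℝ) ≤ n := by exact_mod_cast hn
            nlinarith
        _ = _ := by ring
    calc ‖ξ‖ ^ M ≤ (n * ‖ξ i‖) ^ M := pow_le_pow_left₀ (norm_nonneg _) h1 M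
      _ = (n : ℝ) ^ M * ‖ξ i‖ ^ M := mul_pow _ _ _
      _ ≤ ((n : ℝ) ^ M + 1) * (1 + ∑ j, ‖ξ j‖ ^ M) := by
          gcongr
          · linarith
          · have := Finset.single_le_sum (f := fun j => ‖ξ j‖ ^ M)
              (fun _ _ => by positivity) (Finset.mem_univ i)
            simp only at this
            linarith

/-- Fourier inversion and the Cauchy-Schwarz inequality. -/
theorem exists_enorm_apply_le_sobNorm (n : ℕ) : ∃ M : ℕ, M ≠ 0 ∧ ∃ C : ℝ≥0,
    ∀ (w : 𝓢(EuclideanSpace ℝ (Fin n), ℂ)) (x : EuclideanSpace ℝ (Fin n)),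
      ‖w x‖ₑ ≤ C * sobNorm 1 M w := by
  obtain ⟨k, hk⟩ := Measure.HasTemperateGrowth.exists_eLpNorm_lt_top
    (E := EuclideanSpace ℝ (Fin n)) 2 (μ := volume) inferInstance
  refine ⟨k + 1, by omega, (eLpNorm (fun x : EuclideanSpace ℝ (Fin n) ↦ (1 + ‖x‖) ^ (-k : ℝ)) 2
    volume).toNNReal, fun w x => ?_⟩
  rw [ENNReal.coe_toNNReal hk.ne]
  set g : EuclideanSpace ℝ (Fin n) → ℝ := fun ξ => (1 + ‖ξ‖) ^ (-k : ℝ) with hg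
  have h1 : ‖w x‖ₑ ≤ eLpNorm (fun ξ => 𝓕 w ξ) 1 volume := by
    rw [← FourierTransform.fourierInv_fourier_eq (F := 𝓢(EuclideanSpace ℝ (Fin n), ℂ)) w,
      fourierInv_coe, Real.fourierInv_eq]
    refine (enorm_integral_le_lintegral_enorm _).trans (le_of_eq ?_)
    rw [eLpNorm_one_eq_lintegral_enorm, FourierTransform.fourierInv_fourier_eq]
    refine lintegral_congr fun ξ => ?_
    rw [← ofReal_norm, ← ofReal_norm, Circle.norm_smul]
  have h2 : eLpNorm (fun ξ => 𝓕 w ξ) 1 volume =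
      eLpNorm (g • fun ξ => (1 + 1 * ‖ξ‖) ^ ((k : ℕ) : ℤ) * ‖𝓕 w ξ‖) 1 volume := by
    rw [← eLpNorm_norm]
    congr 1
    ext ξ
    have : 0 < 1 + ‖ξ‖ := by positivity
    simp only [Pi.smul_apply', hg]
    rw [smul_eq_mul, one_mul, ← mul_assoc, Real.rpow_neg this.le,
      Real.rpow_natCast, zpow_natCast, inv_mul_cancel₀ (by positivity), one_mul]
  have hgm : AEStronglyMeasurable g volume := by
    have : Measurable g := by simp only [hg]; fun_prop
    exact this.aestronglyMeasurable
  refine h1.trans (h2.le.trans ?_)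
  refine (eLpNorm_smul_le_mul_eLpNorm (p := 2) (q := 2)
    (measurable_sobNorm_integrand 1 k w) hgm).trans ?_
  refine mul_le_mul_right ?_ _
  exact sobNorm_mono zero_le_one (by push_cast; omega) w

/-- A local Sobolev inequality. -/
theorem exists_enorm_apply_le_localL2 (n : ℕ) : ∃ M : ℕ, ∀ ε : ℝ, 0 < ε → ∃ C : ℝ≥0,
    ∀ (x₀ : EuclideanSpace ℝ (Fin n)) (v : 𝓢(EuclideanSpace ℝ (Fin n), ℂ)) (Q : ℝ≥0∞),
      (∀ l : List (Fin n), l.length ≤ M → localL2 (cube x₀ ε) (listD l v) ≤ Q) →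
      ‖v x₀‖ₑ ≤ C * Q := by
  obtain ⟨M, hM, C₁, h₁⟩ := exists_enorm_apply_le_sobNorm n
  obtain ⟨c, hc⟩ := exists_isScaledCutoff_cube n
  refine ⟨M, fun ε hε => ?_⟩
  obtain ⟨C₂, h₂⟩ := cutoffEstimate (P := fun i : Fin n => MvPolynomial.X i ^ M) (m := M)
    (fun i => (MvPolynomial.totalDegree_X_pow i M).le) (isElliptic_X_pow M hM) M le_rfl
    (fun k => c k / ε ^ k)
  refine ⟨C₁ * (C₂ * (1 + n)), fun x₀ v Q hQ => ?_⟩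
  obtain ⟨χ, hχ, hχ1⟩ := hc ε 0 x₀ hε
  rw [zero_add] at hχ
  have hχ' : IsScaledCutoff (fun k => c k / ε ^ k) 1 (cube x₀ ε) χ :=
    ⟨hχ.contDiff, fun k x => by
      rw [one_pow, one_mul, le_div_iff₀ (by positivity), mul_comm]
      exact hχ.bound k x, hχ.tsupport_subset⟩
  have e : v x₀ = smulLeftCLM ℂ χ v x₀ := by
    rw [smulLeftCLM_apply_apply (hχ.hasTemperateGrowth hε), hχ1 x₀ (by simp [cube]), one_smul]
  have h3 : graphNorm (fun i : Fin n => MvPolynomial.X i ^ M) M 1 (cube x₀ ε) v ≤ (1 + n) * Q := by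
    have h4 : ∀ i : Fin n, localL2 (cube x₀ ε) (polyOp (MvPolynomial.X i ^ M) v) ≤ Q := by
      intro i
      have := hQ (List.replicate M i) (by simp)
      rwa [listD, List.map_replicate, List.prod_replicate] at this
    have h5 : localL2 (cube x₀ ε) v ≤ Q := by
      have := hQ [] (by simp)
      rwa [listD_nil] at this
    rw [graphNorm, one_pow, ENNReal.ofReal_one, one_mul, add_mul, one_mul]
    refine add_le_add h5 ((Finset.sum_le_sum fun i _ => h4 i).trans (le_of_eq ?_))
    simp
  rw [e]
  calc _ ≤ C₁ * sobNorm 1 M (smulLeftCLM ℂ χ v) := h₁ _ _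
    _ ≤ C₁ * (C₂ * ((1 + n) * Q)) := by
        gcongr
        exact (h₂ 1 _ χ v one_pos le_rfl hχ').trans (mul_le_mul_right h3 _)
    _ = _ := by push_cast; ring

/-- Pointwise bounds of derivatives in terms of iterates; `k` steps of width `ε / k` are made
between the cubes of half side lengths `ε` and `2ε`. -/
theorem exists_enorm_listD_le {P : Fin N → MvPolynomial (Fin n) ℂ} {m : ℕ}
    (hP : ∀ j, (P j).totalDegree ≤ m) (hell : IsElliptic P m) :
    ∃ M : ℕ, ∀ ε : ℝ, 0 < ε → ε ≤ 1 → ∃ C : ℝ≥0, 1 ≤ C ∧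
    ∀ (x₀ : EuclideanSpace ℝ (Fin n)) (v : 𝓢(EuclideanSpace ℝ (Fin n), ℂ)) (k : ℕ) (Q : ℝ≥0∞)
      (l : List (Fin n)), k ≠ 0 → l.length + M ≤ m * k →
      (∀ β : Fin N → ℕ, ∑ j, β j ≤ k → ENNReal.ofReal ((ε / k) ^ (m * ∑ j, β j)) *
          localL2 (cube x₀ (2 * ε)) (polyOp (∏ j, P j ^ β j) v) ≤ Q) →
      ENNReal.ofReal ((ε / k) ^ (m * k)) * ‖listD l v x₀‖ₑ ≤ (C : ℝ≥0∞) ^ (k + 1) * Q := by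
  obtain ⟨M, hM⟩ := exists_enorm_apply_le_localL2 n
  obtain ⟨C₁, h₁⟩ := exists_localL2_listD_le_iterate hP hell
  refine ⟨M, fun ε hε hε1 => ?_⟩
  obtain ⟨C₂, h₂⟩ := hM ε hε
  refine ⟨max 1 (max C₁ C₂), le_max_left _ _, fun x₀ v k Q l hk hl hQ => ?_⟩
  have hk1 : (1 : ℝ) ≤ k := by exact_mod_cast Nat.one_le_iff_ne_zero.2 hk
  have hδ : 0 < ε / k := by positivity
  have hδ1 : ε / k ≤ 1 := (div_le_one (by positivity)).2 (hε1.trans hk1)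
  have hd : ENNReal.ofReal ((ε / k) ^ (m * k)) ≠ 0 := by
    rw [Ne, ENNReal.ofReal_eq_zero, not_le]; positivity
  have h3 := h₂ x₀ (listD l v) ((C₁ : ℝ≥0∞) ^ k * Q / ENNReal.ofReal ((ε / k) ^ (m * k)))
    fun l' hl' => by
      rw [ENNReal.le_div_iff_mul_le (Or.inl hd) (Or.inl ENNReal.ofReal_ne_top), mul_comm,
        ← listD_append]
      have hlen : (l' ++ l).length ≤ m * k := by rw [List.length_append]; omega
      refine le_trans (mul_le_mul_left (ENNReal.ofReal_le_ofReal
        (pow_le_pow_of_le_one hδ.le hδ1 hlen)) _) ?_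
      refine h₁ (ε / k) x₀ hδ hδ1 k ε v Q _ hlen fun β hβ => ?_
      have : ε + k * (ε / k) = 2 * ε := by field_simp; ring
      rw [this]
      exact hQ β hβ
  rw [mul_comm]
  rw [← mul_div_assoc, ENNReal.le_div_iff_mul_le (Or.inl hd) (Or.inl ENNReal.ofReal_ne_top)] at h3
  refine h3.trans ?_
  rw [← mul_assoc, pow_succ']
  gcongr
  · exact (le_max_right _ _).trans (le_max_right _ _)
  · exact (le_max_left _ _).trans (le_max_right _ _)

end EllipticRegularity

/-! ### The weight sequences -/

/-- The exponents `λ φ*(x / λ)` of the weight sequences. -/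
noncomputable def scaledConj (ω : ℝ → ℝ) (lam x : ℝ) : ℝ :=
  lam * youngConj ω (x / lam)

theorem weightFactor_eq (ω : ℝ → ℝ) (lam : ℝ) (k : ℕ) :
    weightFactor ω lam k = ENNReal.ofReal (Real.exp (-scaledConj ω lam k)) := rfl

theorem weightFactor_mul_ofReal_exp (ω : ℝ → ℝ) (lam : ℝ) (k : ℕ) :
    weightFactor ω lam k * ENNReal.ofReal (Real.exp (scaledConj ω lam k)) = 1 := by
  rw [weightFactor_eq, ← ENNReal.ofReal_mul (Real.exp_pos _).le, ← Real.exp_add, neg_add_cancel,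
    Real.exp_zero, ENNReal.ofReal_one]

theorem mul_weightFactor_le_iff {ω : ℝ → ℝ} {lam : ℝ} {k : ℕ} {a A : ℝ≥0∞} :
    a * weightFactor ω lam k ≤ A ↔ a ≤ A * ENNReal.ofReal (Real.exp (scaledConj ω lam k)) := by
  have h := weightFactor_mul_ofReal_exp ω lam k
  constructor <;> intro h'
  · calc a = a * weightFactor ω lam k * ENNReal.ofReal (Real.exp (scaledConj ω lam k)) := by
          rw [mul_assoc, h, mul_one]
      _ ≤ _ := mul_le_mul_left h' _
  · calc a * weightFactor ω lam k
        ≤ A * ENNReal.ofReal (Real.exp (scaledConj ω lam k)) * weightFactor ω lam k :=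
          mul_le_mul_left h' _
      _ = A := by rw [mul_assoc, mul_comm (ENNReal.ofReal _), h, mul_one]

theorem scaledConj_le {ω : ℝ → ℝ} {lam : ℝ} (hl : 0 < lam) {x a : ℝ}
    (h : ∀ t, 0 ≤ t → x * t - lam * ω (Real.exp t) ≤ a) : scaledConj ω lam x ≤ a := by
  rw [scaledConj, mul_comm, ← le_div_iff₀ hl]
  refine csSup_le (Set.nonempty_Ici.image _) ?_
  rintro _ ⟨t, ht, rfl⟩
  rw [le_div_iff₀ hl]
  refine le_trans (le_of_eq ?_) (h t ht)
  field_simp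

namespace IsNonQuasianalyticWeight

variable {ω : ℝ → ℝ}

theorem le_scaledConj (hω : IsNonQuasianalyticWeight ω) {lam : ℝ} (hl : 0 < lam) (x : ℝ) {t : ℝ}
    (ht : 0 ≤ t) : x * t - lam * ω (Real.exp t) ≤ scaledConj ω lam x := by
  have h : x / lam * t - ω (Real.exp t) ≤ youngConj ω (x / lam) :=
    le_csSup (hω.bddAbove _) ⟨t, ht, rfl⟩
  calc x * t - lam * ω (Real.exp t) = lam * (x / lam * t - ω (Real.exp t)) := by field_simp
    _ ≤ _ := mul_le_mul_of_nonneg_left h hl.le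

theorem scaledConj_mono (hω : IsNonQuasianalyticWeight ω) {lam : ℝ} (hl : 0 < lam) {x y : ℝ}
    (hxy : x ≤ y) : scaledConj ω lam x ≤ scaledConj ω lam y :=
  scaledConj_le hl fun t ht => le_trans (by gcongr) (hω.le_scaledConj hl y ht)

theorem scaledConj_anti (hω : IsNonQuasianalyticWeight ω) {lam mu : ℝ} (hl : 0 < lam)
    (hlm : lam ≤ mu) (x : ℝ) : scaledConj ω mu x ≤ scaledConj ω lam x := by
  refine scaledConj_le (hl.trans_le hlm) fun t ht => le_trans ?_ (hω.le_scaledConj hl x ht)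
  have := hω.nonneg _ (Real.exp_pos t).le
  gcongr

/-- The weight sequences are supermultiplicative. -/
theorem scaledConj_add_le (hω : IsNonQuasianalyticWeight ω) {lam : ℝ} (hl : 0 < lam) {x y : ℝ}
    (hx : 0 ≤ x) (hy : 0 ≤ y) :
    scaledConj ω lam x + scaledConj ω lam y ≤ scaledConj ω lam (x + y) := by
  have key : ∀ t, 0 ≤ t → ∀ s, 0 ≤ s → (x * t - lam * ω (Real.exp t)) +
      (y * s - lam * ω (Real.exp s)) ≤ scaledConj ω lam (x + y) := by
    intro t ht s hs
    have h1 : 0 ≤ lam * ω (Real.exp t) := mul_nonneg hl.le (hω.nonneg _ (Real.exp_pos t).le)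
    have h2 : 0 ≤ lam * ω (Real.exp s) := mul_nonneg hl.le (hω.nonneg _ (Real.exp_pos s).le)
    rcases le_total s t with h | h
    · have := hω.le_scaledConj hl (x + y) ht
      have h3 : y * s ≤ y * t := by gcongr
      linarith
    · have := hω.le_scaledConj hl (x + y) hs
      have h3 : x * t ≤ x * s := by gcongr
      linarith
  rw [← le_sub_iff_add_le]
  refine scaledConj_le hl fun t ht => ?_
  rw [le_sub_iff_add_le', ← le_sub_iff_add_le]
  refine scaledConj_le hl fun s hs => ?_
  have := key t ht s hs
  linarith

/-- A fixed shift `c` of the order of derivatives costs only a constant factor after halving `λ`. -/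
theorem scaledConj_add_le_half (hω : IsNonQuasianalyticWeight ω) {lam : ℝ} (hl : 0 < lam)
    (x c : ℝ) :
    scaledConj ω lam (x + c) ≤ scaledConj ω (lam / 2) x + scaledConj ω (lam / 2) c := by
  refine scaledConj_le hl fun t ht => ?_
  have h1 := hω.le_scaledConj (half_pos hl) x ht
  have h2 := hω.le_scaledConj (half_pos hl) c ht
  linarith

/-- Condition (α) allows geometric factors to be absorbed by a change of `λ`. -/
theorem exists_scaledConj_div_pow (hω : IsNonQuasianalyticWeight ω) : ∃ L : ℝ, 0 < L ∧
    ∀ (a : ℕ) (lam : ℝ), 0 < lam → ∃ C : ℝ, ∀ x : ℝ,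
      x * (a * Real.log 2) + scaledConj ω lam x ≤ scaledConj ω (lam / L ^ a) x + C := by
  obtain ⟨L, hL, h⟩ := hω.alpha
  have hlog : 0 ≤ Real.log 2 := Real.log_nonneg one_le_two
  have step : ∀ lam : ℝ, 0 < lam → ∀ x : ℝ,
      x * Real.log 2 + scaledConj ω lam x ≤ scaledConj ω (lam / L) x + lam := by
    intro lam hl x
    rw [← le_sub_iff_add_le']
    refine scaledConj_le hl fun t ht => ?_
    have h1 := hω.le_scaledConj (div_pos hl hL) x (add_nonneg ht hlog)
    have h2 := h (Real.exp t) (Real.exp_pos t).le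
    rw [Real.exp_add, Real.exp_log two_pos, mul_comm (Real.exp t)] at h1
    have h3 : lam / L * ω (2 * Real.exp t) ≤ lam / L * (L * (ω (Real.exp t) + 1)) := by gcongr
    have h4 : lam / L * (L * (ω (Real.exp t) + 1)) = lam * ω (Real.exp t) + lam := by
      field_simp
    linarith
  refine ⟨L, hL, fun a => ?_⟩
  induction a with
  | zero => intro lam _; exact ⟨0, fun x => by simp⟩
  | succ a ih =>
    intro lam hl
    obtain ⟨C, hC⟩ := ih (lam / L) (div_pos hl hL)
    refine ⟨C + lam, fun x => ?_⟩
    have h1 := step lam hl x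
    have h2 := hC x
    rw [div_div, ← pow_succ'] at h2
    push_cast
    linarith

/-- Geometric factors and fixed shifts of the order of derivatives are absorbed by a change of `λ`
by a factor that does not depend on `λ`. -/
theorem exists_scaledConj_absorb (hω : IsNonQuasianalyticWeight ω) (a c : ℝ) :
    ∃ L : ℕ, 0 < L ∧ ∀ lam : ℝ, 0 < lam → ∃ C : ℝ, ∀ x : ℝ, 0 ≤ x →
      a * x + scaledConj ω lam (x + c) ≤ scaledConj ω (lam / L) x + C := by
  obtain ⟨L, hL, h⟩ := hω.exists_scaledConj_div_pow
  have hlog : 0 < Real.log 2 := Real.log_pos one_lt_two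
  obtain ⟨A, hA⟩ := exists_nat_ge (a / Real.log 2)
  rw [div_le_iff₀ hlog] at hA
  obtain ⟨L', hL'⟩ := exists_nat_ge (2 * L ^ A)
  have hL'0 : (0 : ℝ) < L' := lt_of_lt_of_le (by positivity) hL'
  refine ⟨L', by exact_mod_cast hL'0, fun lam hl => ?_⟩
  obtain ⟨C, hC⟩ := h A (lam / 2) (half_pos hl)
  refine ⟨C + scaledConj ω (lam / 2) c, fun x hx => ?_⟩
  have h1 := hω.scaledConj_add_le_half hl x c
  have h2 := hC x
  have h3 : scaledConj ω (lam / 2 / L ^ A) x ≤ scaledConj ω (lam / L') x := by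
    refine hω.scaledConj_anti (by positivity) ?_ x
    rw [div_div]
    gcongr
  have h4 : a * x ≤ x * (A * Real.log 2) := by rw [mul_comm]; gcongr
  linarith

/-- Non-quasianalyticity implies `ω(t) = o(t)`. -/
theorem exists_mul_le_add (hω : IsNonQuasianalyticWeight ω) {lam : ℝ} (hl : 0 < lam) :
    ∃ C : ℝ, 0 ≤ C ∧ ∀ r, 1 ≤ r → lam * ω r ≤ r + C := by
  have hint := hω.beta
  have h1 := intervalIntegral_tendsto_integral_Ioi 1 hint Filter.tendsto_id
  have h2 := intervalIntegral_tendsto_integral_Ioi 1 hint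
    (Filter.tendsto_id.const_mul_atTop (two_pos (α := ℝ)))
  have h3 := h2.sub h1
  rw [sub_self] at h3
  have h4 := (h3.eventually (gt_mem_nhds (show (0 : ℝ) < 1 / (4 * lam) by positivity))).and
    (Filter.eventually_ge_atTop 1)
  obtain ⟨T, hT⟩ := Filter.eventually_atTop.1 h4
  have hsmall : ∀ r, T ≤ r → lam * ω r ≤ r := by
    intro r hr
    obtain ⟨h5, h6⟩ := hT r hr
    have hr0 : 0 < r := by linarith
    have hi : ∀ a b : ℝ, 1 ≤ a → a ≤ b →
        IntervalIntegrable (fun t : ℝ => ω t / t ^ 2) volume a b := fun a b ha hab => by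
      rw [intervalIntegrable_iff_integrableOn_Ioc_of_le hab]
      exact hint.mono_set fun x hx => lt_of_le_of_lt ha hx.1
    simp only [id_eq] at h5
    rw [intervalIntegral.integral_interval_sub_left (hi 1 (2 * r) le_rfl (by linarith))
      (hi 1 r le_rfl h6)] at h5
    -- monotonicity of `ω` bounds the integrand below by `ω(r) / (2r)²` on `[r, 2r]`
    have h7 : ∫ _t in r..2 * r, ω r / (2 * r) ^ 2 ≤ ∫ t in r..2 * r, ω t / t ^ 2 := by
      refine intervalIntegral.integral_mono_on (by linarith) intervalIntegrable_const
        (hi r (2 * r) h6 (by linarith)) fun t ht => ?_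
      have ht0 : 0 < t := hr0.trans_le ht.1
      have h8 := hω.monotoneOn (Set.mem_Ici.2 hr0.le) (Set.mem_Ici.2 ht0.le) ht.1
      have h9 := hω.nonneg t ht0.le
      have h10 : t ^ 2 ≤ (2 * r) ^ 2 := pow_le_pow_left₀ ht0.le ht.2 2
      calc ω r / (2 * r) ^ 2 ≤ ω t / (2 * r) ^ 2 := by gcongr
        _ ≤ _ := by gcongr
    rw [intervalIntegral.integral_const, smul_eq_mul] at h7
    have h8 : (2 * r - r) * (ω r / (2 * r) ^ 2) = ω r / (4 * r) := by field_simp; ring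
    rw [h8] at h7
    have h9 := h7.trans_lt h5
    rw [div_lt_div_iff₀ (by positivity) (by positivity)] at h9
    nlinarith
  refine ⟨lam * ω (max T 1), mul_nonneg hl.le (hω.nonneg _ (by positivity)), fun r hr => ?_⟩
  rcases le_total T r with h | h
  · have := hsmall r h
    have h5 := mul_nonneg hl.le (hω.nonneg (max T 1) (by positivity))
    linarith
  · have h5 : ω r ≤ ω (max T 1) :=
      hω.monotoneOn (Set.mem_Ici.2 (by linarith)) (Set.mem_Ici.2 (by positivity))
        (h.trans (le_max_left _ _))
    have h6 : lam * ω r ≤ lam * ω (max T 1) := by gcongr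
    linarith

/-- The weight sequences dominate `i^i e^{-i}`, for every `λ`. -/
theorem exists_pow_self_le (hω : IsNonQuasianalyticWeight ω) {lam : ℝ} (hl : 0 < lam) :
    ∃ C : ℝ, ∀ i : ℕ, (i : ℝ) ^ i ≤ Real.exp (C + i + scaledConj ω lam i) := by
  obtain ⟨C, hC0, hC⟩ := hω.exists_mul_le_add hl
  refine ⟨C + 1, fun i => ?_⟩
  rcases Nat.eq_zero_or_pos i with rfl | hi
  · have h1 := hω.le_scaledConj hl ((0 : ℕ) : ℝ) (le_refl 0)
    have h2 := hC 1 le_rfl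
    simp only [Nat.cast_zero, zero_mul, Real.exp_zero] at h1
    rw [pow_zero]
    refine Real.one_le_exp ?_
    simp only [Nat.cast_zero]
    linarith
  · have hi1 : (1 : ℝ) ≤ i := by exact_mod_cast hi
    -- test the supremum at `t = log i`
    have h1 := hω.le_scaledConj hl (i : ℝ) (Real.log_nonneg hi1)
    rw [Real.exp_log (by linarith)] at h1
    have h2 := hC i hi1
    rw [← Real.log_le_iff_le_exp (by positivity), Real.log_pow]
    linarith

/-- In the iterated elliptic estimate with steps of width `ε / k`, all contributions are dominated
by the one of highest order, up to a geometric factor that does not depend on `λ`. -/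
theorem exists_pow_mul_exp_le (hω : IsNonQuasianalyticWeight ω) {lam : ℝ} (hl : 0 < lam) :
    ∃ C : ℝ, ∀ (ε : ℝ) (m k b : ℕ), 0 < ε → ε ≤ 1 → 0 < m → 0 < k → b ≤ k →
      (ε / k) ^ (m * b) * Real.exp (scaledConj ω lam (m * b : ℕ)) ≤ (ε / k) ^ (m * k) *
        Real.exp (C + (2 - Real.log ε) * (m * k : ℕ) + scaledConj ω lam (m * k : ℕ)) := by
  obtain ⟨C, hC⟩ := hω.exists_pow_self_le hl
  refine ⟨C, fun ε m k b hε hε1 hm hk hb => ?_⟩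
  set q := m * k with hq
  set i := m * (k - b) with hi
  have hqi : q = m * b + i := by rw [hq, hi, ← mul_add]; congr 1; omega
  have hk0 : (0 : ℝ) < k := by exact_mod_cast hk
  have hkq : (k : ℝ) ≤ q := by exact_mod_cast Nat.le_mul_of_pos_left k hm
  have hiq : (i : ℝ) ≤ q := by exact_mod_cast (by omega : i ≤ q)
  have h1 : (q : ℝ) ^ i ≤ Real.exp q * i.factorial := by
    have := Real.pow_div_factorial_le_exp (q : ℝ) (by positivity) i
    rwa [div_le_iff₀ (by positivity)] at this
  have h2 : (i.factorial : ℝ) ≤ Real.exp (C + q + scaledConj ω lam i) := by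
    calc (i.factorial : ℝ) ≤ (i : ℝ) ^ i := by exact_mod_cast Nat.factorial_le_pow i
      _ ≤ Real.exp (C + i + scaledConj ω lam i) := hC i
      _ ≤ _ := by gcongr
  have h3 : ((k : ℝ) / ε) ^ i ≤ Real.exp (C + (2 - Real.log ε) * q + scaledConj ω lam i) := by
    have hlog : Real.log ε ≤ 0 := Real.log_nonpos hε.le hε1
    have h4 : (1 / ε) ^ i ≤ Real.exp (-Real.log ε * q) := by
      rw [one_div, ← Real.exp_log (inv_pos.2 hε), Real.log_inv, ← Real.exp_nat_mul]
      refine Real.exp_le_exp.2 ?_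
      rw [mul_comm]
      exact mul_le_mul_of_nonneg_left hiq (by linarith)
    calc ((k : ℝ) / ε) ^ i = (k : ℝ) ^ i * (1 / ε) ^ i := by rw [← mul_pow]; congr 1; ring
      _ ≤ (Real.exp q * Real.exp (C + q + scaledConj ω lam i)) * Real.exp (-Real.log ε * q) := by
          gcongr
          exact (pow_le_pow_left₀ hk0.le hkq i).trans (h1.trans (by gcongr))
      _ = _ := by rw [← Real.exp_add, ← Real.exp_add]; congr 1; ring
  have h5 := hω.scaledConj_add_le hl (Nat.cast_nonneg (m * b)) (Nat.cast_nonneg i)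
  rw [← Nat.cast_add, ← hqi] at h5
  have h6 : (ε / k) ^ q = (ε / k) ^ (m * b) * (ε / k) ^ i := by rw [hqi, pow_add]
  rw [h6, mul_assoc]
  refine mul_le_mul_of_nonneg_left ?_ (by positivity)
  have h7 : (ε / k) ^ i * ((k : ℝ) / ε) ^ i = 1 := by
    rw [← mul_pow, div_mul_div_comm, mul_comm ε, div_self (by positivity), one_pow]
  calc Real.exp (scaledConj ω lam (m * b : ℕ))
      = (ε / k) ^ i * (((k : ℝ) / ε) ^ i * Real.exp (scaledConj ω lam (m * b : ℕ))) := by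
        rw [← mul_assoc, h7, one_mul]
    _ ≤ (ε / k) ^ i * (Real.exp (C + (2 - Real.log ε) * q + scaledConj ω lam i) *
        Real.exp (scaledConj ω lam (m * b : ℕ))) := by gcongr
    _ ≤ _ := by
        rw [← Real.exp_add]
        refine mul_le_mul_of_nonneg_left (Real.exp_le_exp.2 ?_) (by positivity)
        linarith

end IsNonQuasianalyticWeight

/-! ### Comparison of derivatives and iterates for Schwartz functions -/

/-- Bounds of the iterates on a cube imply bounds of the derivatives at its centre. The loss `L` in
the parameter does not depend on `λ`, which is what the Beurling case requires. -/
theorem exists_listD_le_of_iterates {P : Fin N → MvPolynomial (Fin n) ℂ} {m : ℕ} (hm : 0 < m)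
    (hP : ∀ j, (P j).totalDegree ≤ m) (hell : IsElliptic P m) {ω : ℝ → ℝ}
    (hω : IsNonQuasianalyticWeight ω) {ε : ℝ} (hε : 0 < ε) (hε1 : ε ≤ 1) :
    ∃ L : ℕ, 0 < L ∧ ∀ lam : ℝ, 0 < lam → ∃ C : ℝ≥0,
      ∀ (x₀ : EuclideanSpace ℝ (Fin n)) (v : 𝓢(EuclideanSpace ℝ (Fin n), ℂ)) (A : ℝ≥0∞),
        (∀ β : Fin N → ℕ, localL2 (cube x₀ (2 * ε)) (polyOp (∏ j, P j ^ β j) v) *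
          weightFactor ω lam ((∑ j, β j) * m) ≤ A) →
        ∀ l : List (Fin n), ‖listD l v x₀‖ₑ * weightFactor ω (lam / L) l.length ≤ C * A := by
  obtain ⟨M, hM⟩ := exists_enorm_listD_le hP hell
  obtain ⟨B, hB1, hB⟩ := hM ε hε hε1
  have hB1' : (1 : ℝ) ≤ B := by exact_mod_cast hB1
  have hB0 : (0 : ℝ) < B := by linarith
  have hlogB : 0 ≤ Real.log B := Real.log_nonneg hB1'
  have hlogε : Real.log ε ≤ 0 := Real.log_nonpos hε.le hε1
  set a : ℝ := 2 - Real.log ε + Real.log B with ha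
  have ha0 : 0 ≤ a := by linarith
  set c : ℝ := ((M + m : ℕ) : ℝ) with hc
  obtain ⟨L, hL, habs⟩ := hω.exists_scaledConj_absorb a c
  refine ⟨L, hL, fun lam hl => ?_⟩
  obtain ⟨C₁, h₁⟩ := hω.exists_pow_mul_exp_le hl
  obtain ⟨C₂, h₂⟩ := habs lam hl
  refine ⟨(Real.exp (C₁ + Real.log B + a * c + C₂)).toNNReal, fun x₀ v A hA l => ?_⟩
  rw [mul_weightFactor_le_iff]
  -- enough steps to reach order `l.length + M`, and at most one more than needed
  set k : ℕ := (l.length + M) / m + 1 with hk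
  have hk0 : 0 < k := Nat.succ_pos _
  have hk1 : l.length + M ≤ m * k := by
    have := Nat.div_add_mod (l.length + M) m
    have := Nat.mod_lt (l.length + M) hm
    rw [hk, mul_add, mul_one]; omega
  have hk2 : m * k ≤ l.length + (M + m) := by
    have := Nat.div_add_mod (l.length + M) m
    rw [hk, mul_add, mul_one]; omega
  have hkq : k ≤ m * k := Nat.le_mul_of_pos_left k hm
  set R : ℝ := Real.exp (C₁ + (2 - Real.log ε) * (m * k : ℕ) + scaledConj ω lam (m * k : ℕ))
  set d : ℝ := (ε / k) ^ (m * k) with hd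
  have hd0 : 0 < d := by
    have : (0 : ℝ) < k := by exact_mod_cast hk0
    positivity
  have h3 := hB x₀ v k (ENNReal.ofReal (d * R) * A) l hk0.ne' hk1 fun β hβ => by
    have h4 := mul_weightFactor_le_iff.1 (hA β)
    refine (mul_le_mul_right h4 _).trans ?_
    rw [mul_left_comm, mul_comm, mul_comm (∑ j, β j) m, ← ENNReal.ofReal_mul (by positivity)]
    exact mul_le_mul_left (ENNReal.ofReal_le_ofReal (h₁ ε m k _ hε hε1 hm hk0 hβ)) _
  have h5 : ENNReal.ofReal d * ‖listD l v x₀‖ₑ ≤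
      ENNReal.ofReal d * ((B : ℝ≥0∞) ^ (k + 1) * (ENNReal.ofReal R * A)) := by
    refine h3.trans (le_of_eq ?_)
    rw [ENNReal.ofReal_mul hd0.le]; ring
  have h6 : ‖listD l v x₀‖ₑ ≤ (B : ℝ≥0∞) ^ (k + 1) * (ENNReal.ofReal R * A) :=
    (ENNReal.mul_le_mul_iff_right (by simpa using hd0) ENNReal.ofReal_ne_top).1 h5
  refine h6.trans ?_
  rw [← mul_assoc, mul_right_comm _ A]
  refine mul_le_mul_left ?_ A
  have h7 : (B : ℝ≥0∞) ^ (k + 1) = ENNReal.ofReal (Real.exp ((k + 1 : ℕ) * Real.log B)) := by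
    rw [Real.exp_nat_mul, Real.exp_log hB0, ENNReal.ofReal_pow hB0.le, ENNReal.ofReal_coe_nnreal]
  rw [h7, ← ENNReal.ofReal_mul (Real.exp_pos _).le, ← Real.exp_add]
  change _ ≤ ENNReal.ofReal _ * _
  rw [← ENNReal.ofReal_mul (Real.exp_pos _).le, ← Real.exp_add]
  refine ENNReal.ofReal_le_ofReal (Real.exp_le_exp.2 ?_)
  have h8 : ((m * k : ℕ) : ℝ) ≤ l.length + c := by rw [hc]; exact_mod_cast hk2
  have h9 := hω.scaledConj_mono hl h8
  have h10 := h₂ l.length (Nat.cast_nonneg _)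
  have h11 : a * ((m * k : ℕ) : ℝ) ≤ a * (l.length + c) := mul_le_mul_of_nonneg_left h8 ha0
  have h12 : (k : ℝ) * Real.log B ≤ ((m * k : ℕ) : ℝ) * Real.log B := by
    refine mul_le_mul_of_nonneg_right ?_ hlogB
    exact_mod_cast hkq
  have h13 : a * ((m * k : ℕ) : ℝ) = (2 - Real.log ε) * ((m * k : ℕ) : ℝ) +
      ((m * k : ℕ) : ℝ) * Real.log B := by rw [ha]; ring
  push_cast at *
  linarith

/-- Iterates are pointwise bounded by derivatives: each `P_j(D)` multiplies bounds by at most the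
sum `B` of the absolute values of coefficients. -/
theorem exists_enorm_iterate_le {P : Fin N → MvPolynomial (Fin n) ℂ} {m : ℕ}
    (hP : ∀ j, (P j).totalDegree ≤ m) : ∃ B : ℝ≥0, 1 ≤ B ∧
    ∀ (x : EuclideanSpace ℝ (Fin n)) (b : ℕ) (β : Fin N → ℕ), ∑ j, β j = b →
      ∀ (v : 𝓢(EuclideanSpace ℝ (Fin n), ℂ)) (Q : ℝ≥0∞),
      (∀ l : List (Fin n), l.length ≤ m * b → ‖listD l v x‖ₑ ≤ Q) →
      ‖polyOp (∏ j, P j ^ β j) v x‖ₑ ≤ (B : ℝ≥0∞) ^ b * Q := by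
  choose l hl hl' using exists_list_monomial (n := n)
  set B : ℝ≥0 := 1 + ∑ j, ∑ α ∈ (P j).support, ‖(P j).coeff α‖₊ with hB
  refine ⟨B, le_self_add, fun x b => ?_⟩
  induction b with
  | zero =>
    intro β hβ v Q h
    have hβ0 : β = 0 := by
      ext j
      exact (Finset.sum_eq_zero_iff.1 hβ) j (Finset.mem_univ j)
    have := h [] (by simp)
    simpa [hβ0, polyOp_one, listD_nil] using this
  | succ b ih =>
    intro β hβ v Q h
    obtain ⟨j, hj⟩ : ∃ j, β j ≠ 0 := by
      by_contra hcon
      push Not at hcon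
      simp [hcon] at hβ
    set β' : Fin N → ℕ := β - Pi.single j 1 with hβ'
    have hββ : β = β' + Pi.single j 1 := by
      ext i
      by_cases hij : i = j
      · subst hij; simp [hβ']; omega
      · simp [hβ', hij]
    have hsum : ∑ i, β' i = b := by
      have : ∑ i, β i = ∑ i, β' i + 1 := by rw [hββ]; simp [Finset.sum_add_distrib]
      omega
    rw [hββ, prod_pow_add_single, polyOp_mul]
    refine (ih β' hsum (polyOp (P j) v) (B * Q) fun l₀ hl₀ => ?_).trans
      (le_of_eq (by rw [pow_succ, mul_assoc]))
    have e : listD l₀ (polyOp (P j) v) =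
        ∑ α ∈ (P j).support, (P j).coeff α • listD (l₀ ++ l α) v := by
      rw [polyOp_eq_sum, map_sum]
      refine Finset.sum_congr rfl fun α _ => ?_
      rw [map_smul, listD_append, hl']; rfl
    rw [e, _root_.sum_apply]
    refine (enorm_sum_le _ _).trans ?_
    calc _ ≤ ∑ α ∈ (P j).support, (‖(P j).coeff α‖₊ : ℝ≥0∞) * Q := by
          refine Finset.sum_le_sum fun α hα => ?_
          rw [_root_.smul_apply, enorm_smul, enorm_eq_nnnorm]
          refine mul_le_mul_right (h _ ?_) _
          have : (l α).length ≤ m := by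
            rw [hl]
            exact (MvPolynomial.le_totalDegree hα).trans (hP j)
          rw [List.length_append, mul_add, mul_one]; omega
      _ ≤ B * Q := by
          rw [← Finset.sum_mul]
          refine mul_le_mul_left ?_ _
          have : ∑ α ∈ (P j).support, ‖(P j).coeff α‖₊ ≤ B := by
            rw [hB]
            refine le_trans ?_ le_add_self
            exact Finset.single_le_sum
              (f := fun j => ∑ α ∈ (P j).support, ‖(P j).coeff α‖₊)
              (fun _ _ => zero_le) (Finset.mem_univ j)
          exact_mod_cast this

/-- Bounds of the derivatives at a point imply bounds of the iterates there. -/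
theorem exists_iterates_le_of_listD {P : Fin N → MvPolynomial (Fin n) ℂ} {m : ℕ} (hm : 0 < m)
    (hP : ∀ j, (P j).totalDegree ≤ m) {ω : ℝ → ℝ} (hω : IsNonQuasianalyticWeight ω) :
    ∃ L : ℕ, 0 < L ∧ ∀ lam : ℝ, 0 < lam → ∃ C : ℝ≥0,
      ∀ (x : EuclideanSpace ℝ (Fin n)) (v : 𝓢(EuclideanSpace ℝ (Fin n), ℂ)) (A : ℝ≥0∞),
        (∀ l : List (Fin n), ‖listD l v x‖ₑ * weightFactor ω lam l.length ≤ A) →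
        ∀ β : Fin N → ℕ, ‖polyOp (∏ j, P j ^ β j) v x‖ₑ *
          weightFactor ω (lam / L) ((∑ j, β j) * m) ≤ C * A := by
  obtain ⟨B, hB1, hB⟩ := exists_enorm_iterate_le hP
  have hB1' : (1 : ℝ) ≤ B := by exact_mod_cast hB1
  have hB0 : (0 : ℝ) < B := by linarith
  have hlogB : 0 ≤ Real.log B := Real.log_nonneg hB1'
  obtain ⟨L, hL, habs⟩ := hω.exists_scaledConj_absorb (Real.log B) 0
  refine ⟨L, hL, fun lam hl => ?_⟩
  obtain ⟨C, hC⟩ := habs lam hl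
  refine ⟨(Real.exp C).toNNReal, fun x v A hA β => ?_⟩
  rw [mul_weightFactor_le_iff]
  set b := ∑ j, β j with hb
  have h1 := hB x b β rfl v (ENNReal.ofReal (Real.exp (scaledConj ω lam (b * m : ℕ))) * A)
    fun l hlb => by
      refine (mul_weightFactor_le_iff.1 (hA l)).trans ?_
      rw [mul_comm]
      refine mul_le_mul_left (ENNReal.ofReal_le_ofReal (Real.exp_le_exp.2 ?_)) _
      refine hω.scaledConj_mono hl ?_
      rw [mul_comm] at hlb
      exact_mod_cast hlb
  refine h1.trans ?_
  rw [← mul_assoc, mul_right_comm _ A]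
  refine mul_le_mul_left ?_ A
  have h7 : (B : ℝ≥0∞) ^ b = ENNReal.ofReal (Real.exp (b * Real.log B)) := by
    rw [Real.exp_nat_mul, Real.exp_log hB0, ENNReal.ofReal_pow hB0.le, ENNReal.ofReal_coe_nnreal]
  rw [h7, ← ENNReal.ofReal_mul (Real.exp_pos _).le, ← Real.exp_add]
  change _ ≤ ENNReal.ofReal _ * _
  rw [← ENNReal.ofReal_mul (Real.exp_pos _).le, ← Real.exp_add]
  refine ENNReal.ofReal_le_ofReal (Real.exp_le_exp.2 ?_)
  have h8 := hC (b * m : ℕ) (Nat.cast_nonneg _)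
  rw [add_zero] at h8
  have h9 : (b : ℝ) * Real.log B ≤ Real.log B * (b * m : ℕ) := by
    rw [mul_comm]
    refine mul_le_mul_of_nonneg_left ?_ hlogB
    exact_mod_cast Nat.le_mul_of_pos_right b hm
  linarith

/-! ### Localization -/

theorem iterComp_congr {M : ℕ} {V : Set (EuclideanSpace ℝ (Fin n))}
    {T : Fin M → (EuclideanSpace ℝ (Fin n) → ℂ) → (EuclideanSpace ℝ (Fin n) → ℂ)}
    (hT : ∀ j u v, Set.EqOn u v V → Set.EqOn (T j u) (T j v) V) (β : Fin M → ℕ)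
    {u v : EuclideanSpace ℝ (Fin n) → ℂ} (h : Set.EqOn u v V) :
    Set.EqOn (iterComp T β u) (iterComp T β v) V := by
  have h1 : ∀ (j) (k : ℕ) (u v : EuclideanSpace ℝ (Fin n) → ℂ), Set.EqOn u v V →
      Set.EqOn ((T j)^[k] u) ((T j)^[k] v) V := by
    intro j k
    induction k with
    | zero => intro u v h; exact h
    | succ k ih =>
      intro u v h
      rw [Function.iterate_succ_apply, Function.iterate_succ_apply]
      exact ih _ _ (hT j u v h)
  rw [iterComp, iterComp]
  induction List.finRange M with
  | nil => exact h
  | cons j l ih => exact h1 j _ _ _ ih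

theorem partialD_congr {V : Set (EuclideanSpace ℝ (Fin n))} (hV : IsOpen V) (j : Fin n)
    (u v : EuclideanSpace ℝ (Fin n) → ℂ) (h : Set.EqOn u v V) :
    Set.EqOn (partialD j u) (partialD j v) V := by
  intro x hx
  rw [partialD, partialD, (h.eventuallyEq_of_mem (hV.mem_nhds hx)).fderiv_eq]

theorem multiD_congr {V : Set (EuclideanSpace ℝ (Fin n))} (hV : IsOpen V) (α : Fin n → ℕ)
    {u v : EuclideanSpace ℝ (Fin n) → ℂ} (h : Set.EqOn u v V) :
    Set.EqOn (multiD α u) (multiD α v) V :=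
  iterComp_congr (partialD_congr hV) α h

theorem systemIter_congr {V : Set (EuclideanSpace ℝ (Fin n))} (hV : IsOpen V)
    (P : Fin N → MvPolynomial (Fin n) ℂ) (β : Fin N → ℕ)
    {u v : EuclideanSpace ℝ (Fin n) → ℂ} (h : Set.EqOn u v V) :
    Set.EqOn (systemIter P β u) (systemIter P β v) V := by
  refine iterComp_congr (fun j u v h x hx => ?_) β h
  rw [diffOp, diffOp]
  exact Finset.sum_congr rfl fun α _ => by rw [multiD_congr hV α h hx]

/-- Near a compact subset of `Ω`, a smooth function on `Ω` agrees with a Schwartz function. -/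
theorem exists_schwartz_eqOn {Ω K : Set (EuclideanSpace ℝ (Fin n))} (hΩ : IsOpen Ω)
    (hK : IsCompact K) (hKΩ : K ⊆ Ω) {u : EuclideanSpace ℝ (Fin n) → ℂ}
    (hu : ContDiffOn ℝ ((⊤ : ℕ∞) : WithTop ℕ∞) u Ω) :
    ∃ (v : 𝓢(EuclideanSpace ℝ (Fin n), ℂ)) (V : Set (EuclideanSpace ℝ (Fin n))),
      IsOpen V ∧ K ⊆ V ∧ Set.EqOn u v V := by
  obtain ⟨K₁, hK₁, hKK₁, hK₁Ω⟩ := exists_compact_between hK hΩ hKΩ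
  obtain ⟨f, hf1, hf0, -⟩ := exists_contMDiffMap_one_nhds_of_subset_interior
    (modelWithCornersSelf ℝ (EuclideanSpace ℝ (Fin n))) (n := (⊤ : ℕ∞))
    hK.isClosed hKK₁
  have hfc : ContDiff ℝ ((⊤ : ℕ∞) : WithTop ℕ∞) f := f.contMDiff.contDiff
  have hsupp : tsupport f ⊆ K₁ := by
    refine closure_minimal (fun x hx => ?_) hK₁.isClosed
    by_contra hx'
    exact hx (hf0 x hx')
  have hsm : ContDiff ℝ ((⊤ : ℕ∞) : WithTop ℕ∞) (fun x => f x • u x) := by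
    rw [contDiff_iff_contDiffAt]
    intro x
    by_cases hx : x ∈ Ω
    · exact hfc.contDiffAt.smul (hu.contDiffAt (hΩ.mem_nhds hx))
    · have h1 : x ∉ tsupport f := fun h => hx (hK₁Ω (hsupp h))
      have h2 : (fun x => f x • u x) =ᶠ[nhds x] fun _ => 0 := by
        filter_upwards [notMem_tsupport_iff_eventuallyEq.1 h1] with y hy
        simp [hy]
      exact contDiffAt_const.congr_of_eventuallyEq h2
  have hcs : HasCompactSupport (fun x => f x • u x) :=
    HasCompactSupport.intro hK₁ fun x hx => by simp [hf0 x hx]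
  obtain ⟨V, hV, hKV, hV1⟩ := mem_nhdsSet_iff_exists.1 hf1
  refine ⟨hcs.toSchwartzMap hsm, V, hV, hKV, fun x hx => ?_⟩
  have : f x = 1 := hV1 hx
  simp [this]

theorem multiD_eq_listD {V : Set (EuclideanSpace ℝ (Fin n))} (hV : IsOpen V)
    {u : EuclideanSpace ℝ (Fin n) → ℂ} {v : 𝓢(EuclideanSpace ℝ (Fin n), ℂ)} (h : Set.EqOn u v V)
    (l : List (Fin n)) {x : EuclideanSpace ℝ (Fin n)} (hx : x ∈ V) :
    multiD (fun i => l.count i) u x = listD l v x := by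
  rw [multiD_congr hV _ h hx, multiD_coe, listD]
  congr 2
  rw [Finset.prod_list_map_count]
  refine congrArg polyOp (Finset.prod_subset (Finset.subset_univ _) fun i _ hi => ?_).symm
  rw [List.count_eq_zero_of_not_mem (by simpa using hi), pow_zero]

theorem exists_list_multiD (α : Fin n → ℕ) : ∃ l : List (Fin n), l.length = ∑ i, α i ∧
    ∀ i, l.count i = α i := by
  refine ⟨(Finsupp.equivFunOnFinite.symm α).toMultiset.toList, ?_, fun i => ?_⟩
  · rw [Multiset.length_toList, Finsupp.card_toMultiset, Finsupp.sum_fintype _ _ (by simp)]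
    rfl
  · rw [← Multiset.coe_count, Multiset.coe_toList, Finsupp.count_toMultiset]
    rfl

theorem seminormD_le_iff {V : Set (EuclideanSpace ℝ (Fin n))} (hV : IsOpen V)
    {u : EuclideanSpace ℝ (Fin n) → ℂ} {v : 𝓢(EuclideanSpace ℝ (Fin n), ℂ)} (h : Set.EqOn u v V)
    {K : Set (EuclideanSpace ℝ (Fin n))} (hK : K ⊆ V) {ω : ℝ → ℝ} {lam : ℝ} {A : ℝ≥0∞} :
    seminormD ω K lam u ≤ A ↔
      ∀ x ∈ K, ∀ l : List (Fin n), ‖listD l v x‖ₑ * weightFactor ω lam l.length ≤ A := by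
  simp only [seminormD, iSup_le_iff]
  constructor
  · intro H x hx l
    have := H (fun i => l.count i) x hx
    have hs : ∑ i, l.count i = l.length := by
      simpa using Multiset.sum_count_eq_card (s := Finset.univ) (m := (l : Multiset (Fin n)))
        (fun i _ => Finset.mem_univ i)
    rwa [hs, multiD_eq_listD hV h l (hK hx)] at this
  · intro H α x hx
    obtain ⟨l, hl, hl'⟩ := exists_list_multiD α
    have := H x hx l
    rwa [hl, ← multiD_eq_listD hV h l (hK hx), funext hl'] at this

theorem seminormP_le_iff {V : Set (EuclideanSpace ℝ (Fin n))} (hV : IsOpen V)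
    {u : EuclideanSpace ℝ (Fin n) → ℂ} {v : 𝓢(EuclideanSpace ℝ (Fin n), ℂ)} (h : Set.EqOn u v V)
    {K : Set (EuclideanSpace ℝ (Fin n))} (hK : K ⊆ V) (hKm : MeasurableSet K)
    {P : Fin N → MvPolynomial (Fin n) ℂ} {m : ℕ} {ω : ℝ → ℝ} {lam : ℝ} {A : ℝ≥0∞} :
    seminormP P m ω K lam u ≤ A ↔
      ∀ β : Fin N → ℕ, localL2 K (polyOp (∏ j, P j ^ β j) v) *
        weightFactor ω lam ((∑ j, β j) * m) ≤ A := by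
  simp only [seminormP, iSup_le_iff]
  refine forall_congr' fun β => ?_
  have : eLpNorm (systemIter P β u) 2 (volume.restrict K) =
      localL2 K (polyOp (∏ j, P j ^ β j) v) := by
    refine eLpNorm_congr_ae ?_
    filter_upwards [ae_restrict_mem hKm] with x hx
    rw [systemIter_congr hV P β h (hK hx), systemIter_coe]
  rw [this]

theorem norm_sub_le_of_mem_cube {x₀ x : EuclideanSpace ℝ (Fin n)} {r : ℝ} (hr : 0 ≤ r)
    (h : x ∈ cube x₀ r) : ‖x - x₀‖ ≤ n * r := by
  have h1 : ‖x - x₀‖ ^ 2 ≤ (n * r) ^ 2 := by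
    rw [EuclideanSpace.norm_sq_eq]
    calc ∑ i, ‖(x - x₀) i‖ ^ 2 ≤ ∑ _i : Fin n, r ^ 2 :=
          Finset.sum_le_sum fun i _ => pow_le_pow_left₀ (norm_nonneg _) (h i) 2
      _ = n * r ^ 2 := by simp
      _ ≤ n ^ 2 * r ^ 2 := by
          gcongr
          exact_mod_cast Nat.le_self_pow two_ne_zero n
      _ = _ := by ring
  exact (pow_le_pow_iff_left₀ (norm_nonneg _) (by positivity) two_ne_zero).1 h1

/-- Estimates for iterates on a compact neighbourhood of `K` give estimates for derivatives
on `K`. -/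
theorem exists_seminormD_lt_top {P : Fin N → MvPolynomial (Fin n) ℂ} {m : ℕ} (hm : 0 < m)
    (hP : ∀ j, (P j).totalDegree ≤ m) (hell : IsElliptic P m) {ω : ℝ → ℝ}
    (hω : IsNonQuasianalyticWeight ω) {Ω : Set (EuclideanSpace ℝ (Fin n))} (hΩ : IsOpen Ω)
    {u : EuclideanSpace ℝ (Fin n) → ℂ} (hu : ContDiffOn ℝ ((⊤ : ℕ∞) : WithTop ℕ∞) u Ω)
    {K : Set (EuclideanSpace ℝ (Fin n))} (hKΩ : K ⊆ Ω) (hK : IsCompact K) :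
    ∃ K' ⊆ Ω, IsCompact K' ∧ ∃ L : ℕ, 0 < L ∧ ∀ lam : ℝ, 0 < lam →
      seminormP P m ω K' lam u < ⊤ → seminormD ω K (lam / L) u < ⊤ := by
  obtain ⟨d, hd, hdΩ⟩ := hK.exists_cthickening_subset_open hΩ hKΩ
  set K' := Metric.cthickening d K
  have hK' : IsCompact K' := hK.cthickening
  obtain ⟨v, V, hV, hKV, huv⟩ := exists_schwartz_eqOn hΩ hK' hdΩ hu
  have hKK' : K ⊆ K' := Metric.self_subset_cthickening K
  set ε : ℝ := min 1 (d / (2 * (n + 1))) with hε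
  have hε0 : 0 < ε := by positivity
  have hcube : ∀ x ∈ K, cube x (2 * ε) ⊆ K' := by
    intro x hx y hy
    refine Metric.mem_cthickening_of_dist_le y x d K hx ?_
    rw [dist_eq_norm]
    refine (norm_sub_le_of_mem_cube (by positivity) hy).trans ?_
    have h1 : ε ≤ d / (2 * (n + 1)) := min_le_right _ _
    rw [le_div_iff₀ (by positivity)] at h1
    nlinarith
  obtain ⟨L, hL, h⟩ := exists_listD_le_of_iterates hm hP hell hω hε0 (min_le_left _ _)
  refine ⟨K', hdΩ, hK', L, hL, fun lam hl hfin => ?_⟩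
  obtain ⟨C, hC⟩ := h lam hl
  have h1 := (seminormP_le_iff hV huv hKV hK'.measurableSet).1
    (le_refl (seminormP P m ω K' lam u))
  refine lt_of_le_of_lt ((seminormD_le_iff hV huv (hKK'.trans hKV)).2 fun x hx l =>
    hC x v _ (fun β => le_trans ?_ (h1 β)) l) (ENNReal.mul_lt_top ENNReal.coe_lt_top hfin)
  refine mul_le_mul_left ?_ _
  exact eLpNorm_mono_measure _ (Measure.restrict_mono (hcube x hx) le_rfl)

/-- Estimates for derivatives on `K` give estimates for iterates on `K`. -/
theorem exists_seminormP_lt_top {P : Fin N → MvPolynomial (Fin n) ℂ} {m : ℕ} (hm : 0 < m)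
    (hP : ∀ j, (P j).totalDegree ≤ m) {ω : ℝ → ℝ} (hω : IsNonQuasianalyticWeight ω) :
    ∃ L : ℕ, 0 < L ∧ ∀ lam : ℝ, 0 < lam → ∀ {Ω : Set (EuclideanSpace ℝ (Fin n))},
      IsOpen Ω → ∀ {u : EuclideanSpace ℝ (Fin n) → ℂ},
      ContDiffOn ℝ ((⊤ : ℕ∞) : WithTop ℕ∞) u Ω → ∀ {K : Set (EuclideanSpace ℝ (Fin n))},
      K ⊆ Ω → IsCompact K → seminormD ω K lam u < ⊤ → seminormP P m ω K (lam / L) u < ⊤ := by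
  obtain ⟨L, hL, h⟩ := exists_iterates_le_of_listD hm hP hω
  refine ⟨L, hL, fun lam hl Ω hΩ u hu K hKΩ hK hfin => ?_⟩
  obtain ⟨C, hC⟩ := h lam hl
  obtain ⟨v, V, hV, hKV, huv⟩ := exists_schwartz_eqOn hΩ hK hKΩ hu
  have h1 := (seminormD_le_iff hV huv hKV).1 (le_refl (seminormD ω K lam u))
  have hvol : volume K ^ (2 : ℝ)⁻¹ < ⊤ := ENNReal.rpow_lt_top_of_nonneg (by norm_num)
    hK.measure_lt_top.ne
  refine lt_of_le_of_lt ((seminormP_le_iff hV huv hKV hK.measurableSet).2 fun β => ?_)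
    (ENNReal.mul_lt_top (ENNReal.mul_lt_top ENNReal.coe_lt_top hfin) hvol :
      C * seminormD ω K lam u * volume K ^ (2 : ℝ)⁻¹ < ⊤)
  rw [mul_weightFactor_le_iff]
  have h2 : ∀ᵐ x ∂volume.restrict K, ‖polyOp (∏ j, P j ^ β j) v x‖ₑ ≤ C * seminormD ω K lam u *
      ENNReal.ofReal (Real.exp (scaledConj ω (lam / L) ((∑ j, β j) * m : ℕ))) := by
    filter_upwards [ae_restrict_mem hK.measurableSet] with x hx
    exact mul_weightFactor_le_iff.1 (hC x v _ (h1 x hx) β)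
  refine (eLpNorm_le_of_ae_enorm_bound h2).trans (le_of_eq ?_)
  rw [Measure.restrict_apply_univ]
  norm_num
  ring

end Ultradiff

theorem corollary1 {n N m : ℕ} (hm : 0 < m)
    (P : Fin N → MvPolynomial (Fin n) ℂ)
    (hP : Ultradiff.HasOrder P m) (hell : Ultradiff.IsElliptic P m)
    (Ω : Set (EuclideanSpace ℝ (Fin n))) (hΩ : IsOpen Ω)
    (ω : ℝ → ℝ) (hω : Ultradiff.IsNonQuasianalyticWeight ω) :
    Ultradiff.beurlingIter P m ω Ω = Ultradiff.beurling ω Ω ∧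
      Ultradiff.roumieuIter P m ω Ω = Ultradiff.roumieu ω Ω := by
  have hP' : ∀ j, (P j).totalDegree ≤ m := fun j => (hP j).le
  obtain ⟨L₁, hL₁, h₁⟩ := Ultradiff.exists_seminormP_lt_top hm hP' hω
  have hL₁' : (0 : ℝ) < L₁ := by exact_mod_cast hL₁
  constructor
  · ext u
    constructor
    · rintro ⟨hu, H⟩
      refine ⟨hu, fun K hKΩ hK lam hlam => ?_⟩
      obtain ⟨K', hK'Ω, hK', L, hL, h⟩ :=
        Ultradiff.exists_seminormD_lt_top hm hP' hell hω hΩ hu hKΩ hK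
      have hL' : (0 : ℝ) < L := by exact_mod_cast hL
      have := h (lam * L) (by positivity) (H K' hK'Ω hK' _ (by positivity))
      rwa [mul_div_cancel_right₀ _ hL'.ne'] at this
    · rintro ⟨hu, H⟩
      refine ⟨hu, fun K hKΩ hK lam hlam => ?_⟩
      have := h₁ (lam * L₁) (by positivity) hΩ hu hKΩ hK (H K hKΩ hK _ (by positivity))
      rwa [mul_div_cancel_right₀ _ hL₁'.ne'] at this
  · ext u
    constructor
    · rintro ⟨hu, H⟩
      refine ⟨hu, fun K hKΩ hK => ?_⟩
      obtain ⟨K', hK'Ω, hK', L, hL, h⟩ :=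
        Ultradiff.exists_seminormD_lt_top hm hP' hell hω hΩ hu hKΩ hK
      obtain ⟨l, hl, hfin⟩ := H K' hK'Ω hK'
      refine ⟨l * L, Nat.mul_pos hl hL, ?_⟩
      have := h (1 / l) (by positivity) hfin
      rwa [div_div, ← Nat.cast_mul] at this
    · rintro ⟨hu, H⟩
      refine ⟨hu, fun K hKΩ hK => ?_⟩
      obtain ⟨l, hl, hfin⟩ := H K hKΩ hK
      refine ⟨l * L₁, Nat.mul_pos hl hL₁, ?_⟩
      have := h₁ (1 / l) (by positivity) hΩ hu hKΩ hK hfin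
      rwa [div_div, ← Nat.cast_mul] at this
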